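/- Let $V=V_l\cup V_f$ consist of $n_l$ leaders and $n_f$ followers, $n=n_l+n_f$, with an undirected simple communication graph $G$ on $V$, and neighbour sets $\mathcal N_i$. Let $a=(a_i)_{i\in V}$, $a_i\in\mathbb R^d$, be a nominal configuration and let $w_{ij}=w_{ji}\in\mathbb R$ ($w_{ij}=0$ if $ij$ is not an edge) be an equilibrium stress of $(G,a)$: its stress matrix $\Omega$, with $\Omega_{ii}=\sum_{j\in\mathcal N_i}w_{ij}$, $\Omega_{ij}=-w_{ij}$ for $j\in\mathcal N_i$ and $\Omega_{ij}=0$ otherwise, satisfies $(\Omega\otimes I_d)a=0$. Assume that the leader points $a_i$, $i\in V_l$, affinely span $\mathbb R^d$, and that $\Omega$ is positive semidefinite of rank $n-d-1$. Write $\Omega_{ff}$, $\Omega_{fl}$ for the follower–follower and follower–leader blocks of $\Omega$. Let $A\in\mathbb R^{d\times d}$, $B\in\mathbb R^{d\times m}$ with $(A,B)$ stabilizable, let $P,R_1$ be symmetric positive definite with $PA+A^TP-PBB^TP+R_1=0$, and put $K=-B^TP$. Let $p_i^*=\Upsilon a_i+\upsilon$ ($i\in V_l$) be constant leader targets, with $\Upsilon\in\mathbb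 R^{d\times d}$, $\upsilon\in\mathbb R^d$, and let $v_i\in\mathbb R^m$ ($i\in V_l$) satisfy $(A+BK)p_i^*+Bv_i=0$. Consider the agents $\dot p_i=Ap_i+Bu_i$, $i\in V$, where agent $i$ samples at instants $0=t_0^i<t_1^i<\dots$ (finitely or infinitely many), $\hat p_i(t)=p_i(t_k^i)$ and $\hat y_i(t)=y_i(t_k^i)$ for $t\in[t_k^i,t_{k+1}^i)$, $\epsilon_{p_i}=\hat p_i-p_i$, $\epsilon_{y_i}=\hat y_i-y_i$, and $$u_i=K\hat p_i+v_i,\qquad \dot\gamma_i=\|\epsilon_{p_i}\|^2\qquad(i\in V_l),$$ $$u_i=K\hat p_i+\hat y_i,\quad \dot y_i=-d_i\hat\theta_i,\quad \dot d_i=\hat\theta_i^T\hat\theta_i,\quad \dot\varphi_i=\|\epsilon_{p_i}\|^2,\quad \dot\phi_i=d_i\|\epsilon_{y_i}\|^2\qquad(i\in V_f),$$ with $\hat\theta_i=\sum_{j\in V_f}w_{ij}(\hat y_i-\hat y_j)+\sum_{j\in V_l}w_{ij}(\hat y_i-v_j)$, and initial values $\gamma_i(0)>0$, $\varphi_i(0)>0$,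 $d_i(0)>1$, the other initial values being arbitrary. The sampling instants are given by $t_{k+1}^i=\inf\{t>t_k^i: f_i(t)>0\}$, where $$f_i=\gamma_i\|\epsilon_{p_i}\|^2-\|\hat p_i-p_i^*\|^2-\mu_1e^{-\varpi_1t}\qquad(i\in V_l),$$ $$f_i=\varphi_i\|\epsilon_{p_i}\|^2+\phi_id_i\|\epsilon_{y_i}\|^2-\|\hat\xi_i\|^2-\|\hat\theta_i\|^2-\mu_2e^{-\varpi_2t}\qquad(i\in V_f),$$ with $\hat\xi_i=\sum_{j\in\mathcal N_i}w_{ij}(\hat p_i-\hat p_j)$ and constants $\mu_1,\mu_2,\varpi_1,\varpi_2>0$. (That is, $f_i\le0$ at all times after the updates, and agent $i$ samples at a time $t>0$ only if $f_i$, evaluated before its update, is nonnegative at $t$.) Then for every such evolution the sampling instants do not accumulate at a finite time, so that it exists for all $t\ge0$; the leaders converge to their targets, $\lim_{t\to\infty}(p_i(t)-p_i^*)=0$ for $i\in V_l$; the matrix $\Omega_{ff}$ is invertible and the followers converge to the affine formation, $\lim_{t\to\infty}\bigl[p_f(t)+(\Omega_{ff}^{-1}\Omega_{fl}\otimes I_d)p_l(t)\bigr]=0$;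 and all adaptive gains $d_i,\phi_i,\varphi_i$ ($i\in V_f$) and $\gamma_i$ ($i\in V_l$) are bounded on $[0,\infty)$ and converge to finite constants. -/

import Mathlib

open Matrix Filter Topology
open scoped Kronecker

/-- The agents: `Sum.inl` are the `nl` leaders, `Sum.inr` the `nf` followers. -/
abbrev Agent (nl nf : ℕ) : Type := Fin nl ⊕ Fin nf

/-- The squared Euclidean norm of a vector. -/
def sqNorm {k : ℕ} (x : Fin k → ℝ) : ℝ := x ⬝ᵥ x

/-- The neighbours of agent `i` in the communication graph. -/
noncomputable def neighbors {nl nf : ℕ} (G : SimpleGraph (Agent nl nf)) (i : Agent nl nf) :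
    Finset (Agent nl nf) :=
  open Classical in Finset.univ.filter (fun j => G.Adj i j)

/-- The stress matrix `Ω` of the weights `w` on the edges of `G`. -/
noncomputable def stressMatrix {nl nf : ℕ} (G : SimpleGraph (Agent nl nf))
    (w : Agent nl nf → Agent nl nf → ℝ) : Matrix (Agent nl nf) (Agent nl nf) ℝ :=
  open Classical in Matrix.of fun i j =>
    if i = j then ∑ k ∈ neighbors G i, w i k
    else if G.Adj i j then -w i j
    else 0

/-- `w` is an equilibrium stress of the framework `(G, a)`: symmetric weights carried by the
edges with `(Ω ⊗ I_d) a = 0`, where `a` is stacked into one vector. -/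
structure IsEquilibriumStress {nl nf d : ℕ} (G : SimpleGraph (Agent nl nf))
    (w : Agent nl nf → Agent nl nf → ℝ) (a : Agent nl nf → Fin d → ℝ) : Prop where
  symm : ∀ i j, w i j = w j i
  support : ∀ i j, ¬ G.Adj i j → w i j = 0
  equilibrium :
    (stressMatrix G w ⊗ₖ (1 : Matrix (Fin d) (Fin d) ℝ)) *ᵥ (fun x => a x.1 x.2) = 0

/-- All complex eigenvalues of the real matrix `M` have negative real part. -/
def IsHurwitz {d : ℕ} (M : Matrix (Fin d) (Fin d) ℝ) : Prop :=
  ∀ z ∈ spectrum ℂ (M.map (fun x : ℝ => (x : ℂ))), z.re < 0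

/-- `(A, B)` is stabilizable by a static state feedback. -/
def IsStabilizable {d m : ℕ} (A : Matrix (Fin d) (Fin d) ℝ) (B : Matrix (Fin d) (Fin m) ℝ) :
    Prop :=
  ∃ F : Matrix (Fin m) (Fin d) ℝ, IsHurwitz (A + B * F)

/-- The data of the multi-agent system and of the control and triggering scheme. -/
structure Scheme (nl nf d m : ℕ) where
  /-- system matrix -/
  A : Matrix (Fin d) (Fin d) ℝ
  /-- input matrix -/
  B : Matrix (Fin d) (Fin m) ℝ
  /-- control gain -/
  K : Matrix (Fin m) (Fin d) ℝ
  /-- communication graph -/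
  G : SimpleGraph (Agent nl nf)
  /-- stress weights -/
  w : Agent nl nf → Agent nl nf → ℝ
  /-- target states of the leaders -/
  pStar : Fin nl → Fin d → ℝ
  /-- compensation terms of the leaders -/
  v : Fin nl → Fin m → ℝ
  /-- threshold constants `μ₁ e^{-ϖ₁ t}` (leaders) and `μ₂ e^{-ϖ₂ t}` (followers) -/
  μ₁ : ℝ
  ϖ₁ : ℝ
  μ₂ : ℝ
  ϖ₂ : ℝ

/-- The signals and the triggering instants of an evolution of the closed loop. Only the values
of the signals at nonnegative times before the `horizon` below matter. -/
structure Evolution (nl nf d m : ℕ) where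
  /-- states -/
  p : Agent nl nf → ℝ → Fin d → ℝ
  /-- compensation estimates of the followers -/
  y : Fin nf → ℝ → Fin m → ℝ
  /-- adaptive coupling parameters `d_i` of the followers -/
  coupling : Fin nf → ℝ → ℝ
  /-- adaptive parameters `γ_i` of the leaders -/
  γ : Fin nl → ℝ → ℝ
  /-- adaptive parameters `\phi_i` of the followers that weigh the compensation error -/
  phi : Fin nf → ℝ → ℝ
  /-- adaptive parameters `\varphi_i` of the followers that weigh the state error -/
  varphi : Fin nf → ℝ → ℝ
  /-- `τ i k` is the `k`-th triggering instant of agent `i`, and `⊤` if agent `i` triggers fewer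
  than `k` times after time `0`. -/
  τ : Agent nl nf → ℕ → EReal

namespace Evolution

variable {nl nf d m : ℕ} (e : Evolution nl nf d m)

/-- The first accumulation point of triggering instants, `⊤` if there is none: the closed loop
evolves on `[0, horizon)`. -/
noncomputable def horizon : EReal := ⨅ i, ⨆ k, e.τ i k

/-- At time `t`, after the updates at `t`, each agent `j` holds its `σ j`-th sample. -/
def Holds (σ : Agent nl nf → ℕ) (t : ℝ) : Prop :=
  ∀ j, e.τ j (σ j) ≤ (t : EReal) ∧ (t : EReal) < e.τ j (σ j + 1)

/-- In the course of the updates at time `t`, an agent `j` which triggers at `t` may still hold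
its previous sample or already the new one. -/
def HoldsDuringUpdate (σ : Agent nl nf → ℕ) (t : ℝ) : Prop :=
  ∀ j, e.τ j (σ j) ≤ (t : EReal) ∧ (t : EReal) ≤ e.τ j (σ j + 1)

/-- The sampled state `p̂_j`, when agents hold the samples `σ`. -/
def pHat (σ : Agent nl nf → ℕ) (j : Agent nl nf) : Fin d → ℝ :=
  e.p j (e.τ j (σ j)).toReal

/-- The sampled compensation estimate `ŷ_j` of a follower. -/
def yHat (σ : Agent nl nf → ℕ) (j : Fin nf) : Fin m → ℝ :=
  e.y j (e.τ (Sum.inr j) (σ (Sum.inr j))).toReal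

/-- The state measurement error `ε_{p_i} = p̂_i - p_i(t)`. -/
def errP (σ : Agent nl nf → ℕ) (t : ℝ) (i : Agent nl nf) : Fin d → ℝ :=
  e.pHat σ i - e.p i t

/-- The compensation measurement error `ε_{y_i} = ŷ_i - y_i(t)`. -/
def errY (σ : Agent nl nf → ℕ) (t : ℝ) (i : Fin nf) : Fin m → ℝ :=
  e.yHat σ i - e.y i t

/-- The combined state measurement `ξ̂_i`. -/
noncomputable def xiHat (S : Scheme nl nf d m) (σ : Agent nl nf → ℕ) (i : Agent nl nf) :
    Fin d → ℝ :=
  ∑ j ∈ neighbors S.G i, S.w i j • (e.pHat σ i - e.pHat σ j)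

/-- The combined compensation measurement `θ̂_i` of a follower. -/
def thetaHat (S : Scheme nl nf d m) (σ : Agent nl nf → ℕ) (i : Fin nf) : Fin m → ℝ :=
  (∑ j : Fin nf, S.w (Sum.inr i) (Sum.inr j) • (e.yHat σ i - e.yHat σ j)) +
    ∑ j : Fin nl, S.w (Sum.inr i) (Sum.inl j) • (e.yHat σ i - S.v j)

/-- The event-triggered control inputs. -/
def input (S : Scheme nl nf d m) (σ : Agent nl nf → ℕ) : Agent nl nf → Fin m → ℝ
  | Sum.inl i => S.K *ᵥ e.pHat σ (Sum.inl i) + S.v i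
  | Sum.inr i => S.K *ᵥ e.pHat σ (Sum.inr i) + e.yHat σ i

/-- The triggering functions `f_i`. -/
noncomputable def trigger (S : Scheme nl nf d m) (σ : Agent nl nf → ℕ) (t : ℝ) :
    Agent nl nf → ℝ
  | Sum.inl i =>
      e.γ i t * sqNorm (e.errP σ t (Sum.inl i))
        - sqNorm (e.pHat σ (Sum.inl i) - S.pStar i) - S.μ₁ * Real.exp (-S.ϖ₁ * t)
  | Sum.inr i =>
      e.varphi i t * sqNorm (e.errP σ t (Sum.inr i))
        + e.phi i t * e.coupling i t * sqNorm (e.errY σ t i)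
        - sqNorm (e.xiHat S σ (Sum.inr i)) - sqNorm (e.thetaHat S σ i)
        - S.μ₂ * Real.exp (-S.ϖ₂ * t)

end Evolution

/-- `e` is an evolution of the closed loop formed by the agents `ṗ_i = A p_i + B u_i`, the control
protocol, the adaptation laws and the event-triggering rule. The right-hand sides are
right-continuous step by step, so the differential equations are stated with continuous signals
and right derivatives. -/
structure IsEvolution {nl nf d m : ℕ} (S : Scheme nl nf d m) (e : Evolution nl nf d m) :
    Prop where
  τ_zero : ∀ i, e.τ i 0 = 0
  τ_lt : ∀ i k, e.τ i k ≠ ⊤ → e.τ i k < e.τ i (k + 1)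
  τ_top : ∀ i k, e.τ i k = ⊤ → e.τ i (k + 1) = ⊤
  /- No triggering is missed: until its next triggering instant, the triggering function of an
  agent does not become positive. -/
  trigger_nonpos : ∀ (t : ℝ) (σ : Agent nl nf → ℕ), 0 ≤ t → e.Holds σ t →
    ∀ i, e.trigger S σ t i ≤ 0
  /- Agent `i` triggers only when its triggering function, with its sample still held, has come up
  to zero; `σ` are the samples held at that stage of the (possibly several, successive) updates
  at this instant. Since the triggering functions are right-continuous, every evolution with
  `t_{k+1} = inf {t > t_k | f_i(t) > 0}` has this property and the previous one; that infimum
  refers to the motion with the held sample, which `e` itself leaves at `t_{k+1}`. -/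
  trigger_nonneg : ∀ (i : Agent nl nf) (k : ℕ) (t : ℝ),
    e.τ i (k + 1) = (t : EReal) → (t : EReal) < e.horizon →
    ∃ σ : Agent nl nf → ℕ, σ i = k ∧ e.HoldsDuringUpdate σ t ∧ 0 ≤ e.trigger S σ t i
  continuous_p : ∀ i, ContinuousOn (e.p i) {t : ℝ | 0 ≤ t ∧ (t : EReal) < e.horizon}
  continuous_y : ∀ i, ContinuousOn (e.y i) {t : ℝ | 0 ≤ t ∧ (t : EReal) < e.horizon}
  continuous_coupling :
    ∀ i, ContinuousOn (e.coupling i) {t : ℝ | 0 ≤ t ∧ (t : EReal) < e.horizon}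
  continuous_γ : ∀ i, ContinuousOn (e.γ i) {t : ℝ | 0 ≤ t ∧ (t : EReal) < e.horizon}
  continuous_phi : ∀ i, ContinuousOn (e.phi i) {t : ℝ | 0 ≤ t ∧ (t : EReal) < e.horizon}
  continuous_varphi : ∀ i, ContinuousOn (e.varphi i) {t : ℝ | 0 ≤ t ∧ (t : EReal) < e.horizon}
  deriv_p : ∀ (t : ℝ) (σ : Agent nl nf → ℕ), 0 ≤ t → e.Holds σ t → ∀ i,
    HasDerivWithinAt (e.p i) (S.A *ᵥ e.p i t + S.B *ᵥ e.input S σ i) (Set.Ici t) t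
  deriv_y : ∀ (t : ℝ) (σ : Agent nl nf → ℕ), 0 ≤ t → e.Holds σ t → ∀ i,
    HasDerivWithinAt (e.y i) (-(e.coupling i t • e.thetaHat S σ i)) (Set.Ici t) t
  deriv_coupling : ∀ (t : ℝ) (σ : Agent nl nf → ℕ), 0 ≤ t → e.Holds σ t → ∀ i,
    HasDerivWithinAt (e.coupling i) (e.thetaHat S σ i ⬝ᵥ e.thetaHat S σ i) (Set.Ici t) t
  deriv_γ : ∀ (t : ℝ) (σ : Agent nl nf → ℕ), 0 ≤ t → e.Holds σ t → ∀ i,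
    HasDerivWithinAt (e.γ i) (sqNorm (e.errP σ t (Sum.inl i))) (Set.Ici t) t
  deriv_varphi : ∀ (t : ℝ) (σ : Agent nl nf → ℕ), 0 ≤ t → e.Holds σ t → ∀ i,
    HasDerivWithinAt (e.varphi i) (sqNorm (e.errP σ t (Sum.inr i))) (Set.Ici t) t
  deriv_phi : ∀ (t : ℝ) (σ : Agent nl nf → ℕ), 0 ≤ t → e.Holds σ t → ∀ i,
    HasDerivWithinAt (e.phi i) (e.coupling i t * sqNorm (e.errY σ t i)) (Set.Ici t) t
  init_coupling : ∀ i, 1 < e.coupling i 0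
  init_γ : ∀ i, 0 < e.γ i 0
  init_varphi : ∀ i, 0 < e.varphi i 0

/-!
The evolution lives on `[0, horizon)`, where all signals are continuous with right derivatives, so
every estimate is a comparison of right derivatives. The point is to bound the adaptive gains on
this interval without knowing whether it is finite. Since each gain is monotone, its derivative
then has finite total mass, and the rest follows.

*Leaders.* The Riccati equation makes `x ⬝ᵥ P *ᵥ x` decay along the target error `x` up to a multiple
of `‖ε‖²` (`riccati_dissipation`). The triggering rule bounds `γ ‖ε‖²` by `2 ‖x‖² + 2 ‖ε‖²` plus an
integrable term, and `γ̇ = ‖ε‖²`, so adding `(γ - c)² / 2` for a large `c` compensates the errors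
(`IsEvolution.leader_bounded`).

*Followers.* The combined states `ξ_i = ∑ j, Ω i j p_j` obey the same closed loop, perturbed by the
errors and driven by `θ̂_i`. Let `Y` be the stack of the `v_i` and the `y_i`. The energy `Yᵀ Ω Y` is
nonnegative because `Ω` is positive semidefinite, and it dissipates `∑ d_i ‖θ̂_i‖²` up to cross terms
`d_i θ̂_i ⬝ ε_{y_j}`. These involve the gain of agent `i` and the error of agent `j`, while the
adaptation of `phi_j` only controls `d_j ‖ε_{y_j}‖²`, and the ratio `d_i / d_j` is not known to be
bounded. Dividing the energy by `h = √(1 + ∑ d_i²)` removes the ratio, and what remains of the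
dissipation after Young's inequality is `-ḣ` (`IsEvolution.deriv_energy_div_gainNorm`). As
`∑ ‖θ̂_i‖²` is the derivative of `∑ d_i`, which is at most a multiple of `h`, a small multiple of the
energy of the `ξ_i` and of
`∑ ((phi_i - c)² + (varphi_i - c)²) / 2` can be added at a cost that `h` absorbs
(`IsEvolution.lyapunov_bounded`).

*Consequences.* On a finite interval the signals then have finite variation, so the errors at
accumulating triggering instants would tend to zero, whereas the triggering rule keeps them above a
positive threshold (`IsEvolution.horizon_eq_top`). On `[0, ∞)` the energies decay exponentially up to
an integrable forcing term, and hence tend to zero (`tendsto_zero_of_right_deriv_le`). Finally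
`Ω_ff` is invertible, since the kernel of `Ω` consists of affine functions of the configuration and
those that vanish on the leaders are zero; so `ξ → 0` is convergence to the affine formation.
-/

/-! ### Comparison principles for right derivatives -/

theorem le_of_right_deriv_nonpos {D : Set ℝ} (hD : D.OrdConnected) {f : ℝ → ℝ}
    (hf : ContinuousOn f D)
    (hf' : ∀ t ∈ D, ∃ c, HasDerivWithinAt f c (Set.Ici t) t ∧ c ≤ 0)
    {s t : ℝ} (hs : s ∈ D) (ht : t ∈ D) (hst : s ≤ t) : f t ≤ f s := by
  classical
  have hsub : Set.Icc s t ⊆ D := hD.out hs ht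
  choose! g hg hg0 using hf'
  exact image_le_of_deriv_right_le_deriv_boundary (hf.mono hsub)
    (fun x hx => hg x (hsub (Set.Ico_subset_Icc_self hx)))
    (B := fun _ => f s) le_rfl continuousOn_const (fun x _ => hasDerivWithinAt_const ..)
    (fun x hx => hg0 x (hsub (Set.Ico_subset_Icc_self hx))) ⟨hst, le_rfl⟩

theorem le_of_right_deriv_nonneg {D : Set ℝ} (hD : D.OrdConnected) {f : ℝ → ℝ}
    (hf : ContinuousOn f D)
    (hf' : ∀ t ∈ D, ∃ c, HasDerivWithinAt f c (Set.Ici t) t ∧ 0 ≤ c)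
    {s t : ℝ} (hs : s ∈ D) (ht : t ∈ D) (hst : s ≤ t) : f s ≤ f t := by
  have := le_of_right_deriv_nonpos hD (f := fun t => -f t) hf.neg
    (fun t ht => by
      obtain ⟨c, hc, h0⟩ := hf' t ht
      exact ⟨-c, hc.neg, by linarith⟩) hs ht hst
  linarith

/-- The increments of a vector function are bounded by those of a real function whose right
derivative dominates the norm of its right derivative. -/
theorem norm_sub_le_of_right_deriv_le {E : Type*} [NormedAddCommGroup E] [NormedSpace ℝ E]
    {D : Set ℝ} (hD : D.OrdConnected) {f : ℝ → E} {g : ℝ → ℝ}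
    (hf : ContinuousOn f D) (hg : ContinuousOn g D)
    (h : ∀ t ∈ D, ∃ f' g', HasDerivWithinAt f f' (Set.Ici t) t ∧
      HasDerivWithinAt g g' (Set.Ici t) t ∧ ‖f'‖ ≤ g')
    {s t : ℝ} (hs : s ∈ D) (ht : t ∈ D) (hst : s ≤ t) : ‖f t - f s‖ ≤ g t - g s := by
  classical
  have hsub : Set.Icc s t ⊆ D := hD.out hs ht
  choose! f' g' hf' hg' hb using h
  have hI : ∀ x ∈ Set.Ico s t, x ∈ D := fun x hx => hsub (Set.Ico_subset_Icc_self hx)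
  exact image_norm_le_of_norm_deriv_right_le_deriv_boundary' (f := fun x => f x - f s)
    (B := fun x => g x - g s) ((hf.mono hsub).sub continuousOn_const)
    (fun x hx => (hf' x (hI x hx)).sub_const _) (by simp)
    ((hg.mono hsub).sub continuousOn_const)
    (fun x hx => (hg' x (hI x hx)).sub_const _)
    (fun x hx => hb x (hI x hx)) ⟨hst, le_rfl⟩

/-- A nonnegative function that decays exponentially up to a forcing term of finite total mass
tends to zero; the forcing term is the derivative of the bounded monotone function `g`. -/
theorem tendsto_zero_of_right_deriv_le {f g : ℝ → ℝ} {δ M : ℝ} (hδ : 0 < δ)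
    (hf : ContinuousOn f (Set.Ici 0)) (hg : ContinuousOn g (Set.Ici 0))
    (hf0 : ∀ t, 0 ≤ t → 0 ≤ f t)
    (hgmono : ∀ s t, 0 ≤ s → s ≤ t → g s ≤ g t) (hgM : ∀ t, 0 ≤ t → g t ≤ M)
    (h : ∀ t, 0 ≤ t → ∃ f' g', HasDerivWithinAt f f' (Set.Ici t) t ∧
      HasDerivWithinAt g g' (Set.Ici t) t ∧ f' ≤ -δ * f t + g') :
    Tendsto f atTop (𝓝 0) := by
  -- Duhamel's bound from the starting time `s`
  have key : ∀ s t, 0 ≤ s → s ≤ t → f t ≤ Real.exp (-δ * (t - s)) * f s + (g t - g s) := by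
    intro s t hs hst
    have hexp : ∀ x : ℝ, HasDerivAt (fun x => Real.exp (δ * x)) (Real.exp (δ * x) * δ) x := by
      intro x
      simpa using ((hasDerivAt_id x).const_mul δ).exp
    have := le_of_right_deriv_nonpos (D := Set.Ici s) Set.ordConnected_Ici
      (f := fun x => Real.exp (δ * x) * (f x - (g x - g s)))
      (by
        have hsub : Set.Ici s ⊆ Set.Ici (0 : ℝ) := Set.Ici_subset_Ici.2 hs
        have h1 := hf.mono hsub
        have h2 := hg.mono hsub
        fun_prop)
      (fun x hx => by
        have hx : s ≤ x := hx
        obtain ⟨f', g', hf', hg', hle⟩ := h x (hs.trans hx)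
        refine ⟨_, (hexp x).hasDerivWithinAt.mul (hf'.sub (hg'.sub_const (g s))), ?_⟩
        have h1 := hgmono s x hs hx
        have h2 := Real.exp_pos (δ * x)
        have h3 : δ * (f x - (g x - g s)) + (f' - g') ≤ 0 := by nlinarith
        have h4 := mul_nonpos_of_nonneg_of_nonpos h2.le h3
        linarith)
      (s := s) (t := t) (Set.mem_Ici.2 le_rfl) hst hst
    simp only [sub_self, sub_zero] at this
    have h5 : Real.exp (-δ * (t - s)) = Real.exp (δ * s) * Real.exp (-(δ * t)) := by
      rw [← Real.exp_add]; ring_nf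
    have h6 : Real.exp (δ * t) * Real.exp (-(δ * t)) = 1 := by rw [← Real.exp_add]; simp
    have h7 := mul_le_mul_of_nonneg_right this (Real.exp_pos (-(δ * t))).le
    have h8 : Real.exp (δ * t) * (f t - (g t - g s)) * Real.exp (-(δ * t))
        = f t - (g t - g s) := by
      calc _ = (Real.exp (δ * t) * Real.exp (-(δ * t))) * (f t - (g t - g s)) := by ring
        _ = _ := by rw [h6, one_mul]
    have h9 : Real.exp (-δ * (t - s)) * f s
        = Real.exp (δ * s) * f s * Real.exp (-(δ * t)) := by rw [h5]; ring
    linarith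
  have hbdd : BddAbove (g '' Set.Ici 0) := ⟨M, by rintro _ ⟨t, ht, rfl⟩; exact hgM t ht⟩
  have hle : ∀ t, 0 ≤ t → g t ≤ sSup (g '' Set.Ici 0) := fun t ht =>
    le_csSup hbdd ⟨t, ht, rfl⟩
  rw [Metric.tendsto_atTop]
  intro η hη
  obtain ⟨_, ⟨s, hs, rfl⟩, hs'⟩ := exists_lt_of_lt_csSup
    (Set.image_nonempty.2 ⟨0, Set.mem_Ici.2 le_rfl⟩)
    (show sSup (g '' Set.Ici 0) - η / 2 < sSup (g '' Set.Ici 0) by linarith)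
  have hlim : Tendsto (fun t => Real.exp (-δ * (t - s)) * f s) atTop (𝓝 0) := by
    have h1 : Tendsto (fun t : ℝ => -δ * (t - s)) atTop atBot :=
      (tendsto_id.atTop_add tendsto_const_nhds).const_mul_atTop_of_neg (by linarith)
    simpa using (Real.tendsto_exp_atBot.comp h1).mul_const (f s)
  obtain ⟨N, hN⟩ := Filter.eventually_atTop.1 (hlim.eventually_lt_const (half_pos hη))
  refine ⟨max N s, fun t ht => ?_⟩
  have hst : s ≤ t := le_of_max_le_right ht
  have h1 := key s t hs hst
  have h2 := hN t (le_of_max_le_left ht)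
  have h0 : 0 ≤ t := le_trans hs hst
  have h3 := hle t h0
  rw [Real.dist_eq, sub_zero, abs_of_nonneg (hf0 t h0)]
  linarith

theorem exists_tendsto_of_mono_bdd {g : ℝ → ℝ} {M : ℝ}
    (hgmono : ∀ s t, 0 ≤ s → s ≤ t → g s ≤ g t) (hgM : ∀ t, 0 ≤ t → g t ≤ M) :
    ∃ c, Tendsto g atTop (𝓝 c) := by
  have hm : Monotone fun t => g (max t 0) := fun s t hst =>
    hgmono _ _ (le_max_right _ _) (max_le_max_right _ hst)
  refine ⟨_, (tendsto_atTop_ciSup hm ⟨M, ?_⟩).congr' ?_⟩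
  · rintro _ ⟨t, rfl⟩
    exact hgM _ (le_max_right _ _)
  · filter_upwards [eventually_ge_atTop 0] with t ht
    simp [ht]

/-! ### Squared norms and quadratic forms -/

theorem HasDerivWithinAt.dotProduct {ι : Type*} [Fintype ι] {x y : ℝ → ι → ℝ} {x' y' : ι → ℝ}
    {s : Set ℝ} {t : ℝ} (hx : HasDerivWithinAt x x' s t) (hy : HasDerivWithinAt y y' s t) :
    HasDerivWithinAt (fun t => x t ⬝ᵥ y t) (x' ⬝ᵥ y t + x t ⬝ᵥ y') s t := by
  rw [hasDerivWithinAt_pi] at hx hy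
  simpa [_root_.dotProduct, Finset.sum_add_distrib] using
    HasDerivWithinAt.fun_sum (u := Finset.univ) fun i _ => (hx i).mul (hy i)

theorem HasDerivWithinAt.mulVec {ι κ : Type*} [Fintype ι] [Fintype κ] (M : Matrix κ ι ℝ)
    {x : ℝ → ι → ℝ} {x' : ι → ℝ}
    {s : Set ℝ} {t : ℝ} (hx : HasDerivWithinAt x x' s t) :
    HasDerivWithinAt (fun t => M *ᵥ x t) (M *ᵥ x') s t := by
  rw [hasDerivWithinAt_pi] at hx ⊢
  intro i
  exact HasDerivWithinAt.fun_sum fun j _ => (hx j).const_mul (M i j)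

theorem ContinuousOn.mulVec {ι κ : Type*} [Fintype ι] [Fintype κ] (M : Matrix κ ι ℝ)
    {x : ℝ → ι → ℝ} {s : Set ℝ} (hx : ContinuousOn x s) :
    ContinuousOn (fun t => M *ᵥ x t) s := by
  rw [continuousOn_pi] at hx ⊢
  intro i
  exact continuousOn_finsetSum _ fun j _ => continuousOn_const.mul (hx j)

theorem ContinuousOn.dotProduct {ι : Type*} [Fintype ι] {x y : ℝ → ι → ℝ} {s : Set ℝ}
    (hx : ContinuousOn x s) (hy : ContinuousOn y s) :
    ContinuousOn (fun t => x t ⬝ᵥ y t) s := by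
  rw [continuousOn_pi] at hx hy
  exact continuousOn_finsetSum _ fun j _ => (hx j).mul (hy j)

theorem sqNorm_eq {k : ℕ} (x : Fin k → ℝ) : sqNorm x = ∑ i, x i ^ 2 := by
  simp [sqNorm, dotProduct, sq]

theorem sqNorm_nonneg {k : ℕ} (x : Fin k → ℝ) : 0 ≤ sqNorm x := by
  rw [sqNorm_eq]; positivity

theorem sqNorm_add_le {k : ℕ} (x y : Fin k → ℝ) :
    sqNorm (x + y) ≤ 2 * sqNorm x + 2 * sqNorm y := by
  simp only [sqNorm_eq, Finset.mul_sum, ← Finset.sum_add_distrib, Pi.add_apply]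
  exact Finset.sum_le_sum fun i _ => by nlinarith [sq_nonneg (x i - y i)]

theorem two_mul_dotProduct_le {k : ℕ} (x y : Fin k → ℝ) :
    2 * (x ⬝ᵥ y) ≤ sqNorm x + sqNorm y := by
  simp only [sqNorm_eq, dotProduct, Finset.mul_sum, ← Finset.sum_add_distrib]
  exact Finset.sum_le_sum fun i _ => by nlinarith [sq_nonneg (x i - y i)]

theorem sqNorm_neg {k : ℕ} (x : Fin k → ℝ) : sqNorm (-x) = sqNorm x := by
  simp [sqNorm_eq]

theorem abs_apply_le_of_sqNorm_le {k : ℕ} {x : Fin k → ℝ} {M : ℝ} (h : sqNorm x ≤ M)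
    (i : Fin k) : |x i| ≤ M + 1 := by
  have h1 : x i ^ 2 ≤ sqNorm x := by
    rw [sqNorm_eq]
    exact Finset.single_le_sum (f := fun i => x i ^ 2) (fun i _ => sq_nonneg _)
      (Finset.mem_univ i)
  rw [abs_le]
  constructor <;> nlinarith [sq_nonneg (x i - 1), sq_nonneg (x i + 1)]

theorem sqNorm_le_card_mul_norm_sq {k : ℕ} (x : Fin k → ℝ) : sqNorm x ≤ k * ‖x‖ ^ 2 := by
  rw [sqNorm_eq]
  calc ∑ i, x i ^ 2 ≤ ∑ _i : Fin k, ‖x‖ ^ 2 := Finset.sum_le_sum fun i _ => by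
        rw [← sq_abs]
        exact pow_le_pow_left₀ (abs_nonneg _) (norm_le_pi_norm x i) 2
    _ = k * ‖x‖ ^ 2 := by simp

theorem norm_sq_le_sqNorm {k : ℕ} (x : Fin k → ℝ) : ‖x‖ ^ 2 ≤ sqNorm x := by
  have h : ‖x‖ ≤ √(sqNorm x) := by
    refine (pi_norm_le_iff_of_nonneg (Real.sqrt_nonneg _)).2 fun i => Real.abs_le_sqrt ?_
    rw [sqNorm_eq]
    exact Finset.single_le_sum (f := fun i => x i ^ 2) (fun i _ => sq_nonneg _)
      (Finset.mem_univ i)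
  calc ‖x‖ ^ 2 ≤ √(sqNorm x) ^ 2 := pow_le_pow_left₀ (norm_nonneg _) h 2
    _ = sqNorm x := Real.sq_sqrt (sqNorm_nonneg x)

theorem tendsto_zero_of_sqNorm {k : ℕ} {α : Type*} {l : Filter α} {x : α → Fin k → ℝ}
    (h : Tendsto (fun t => sqNorm (x t)) l (𝓝 0)) : Tendsto x l (𝓝 0) := by
  rw [tendsto_zero_iff_norm_tendsto_zero]
  have h1 : Tendsto (fun t => √(sqNorm (x t))) l (𝓝 0) := by
    simpa [Function.comp_def] using (Real.continuous_sqrt.tendsto 0).comp h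
  exact squeeze_zero (fun _ => norm_nonneg _)
    (fun t => Real.le_sqrt_of_sq_le (norm_sq_le_sqNorm _)) h1

theorem sqNorm_sum_smul_le {ι : Type*} [Fintype ι] {k : ℕ} (c : ι → ℝ) (x : ι → Fin k → ℝ) :
    sqNorm (∑ j, c j • x j) ≤ (∑ j, c j ^ 2) * ∑ j, sqNorm (x j) := by
  simp only [sqNorm_eq, Finset.sum_apply, Pi.smul_apply, smul_eq_mul]
  rw [Finset.sum_comm, Finset.mul_sum]
  exact Finset.sum_le_sum fun i _ =>
    Finset.sum_mul_sq_le_sq_mul_sq Finset.univ c (fun j => x j i)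

/-- Squared operator norms are finite. -/
theorem exists_sqNorm_mulVec_le {k l : ℕ} (M : Matrix (Fin l) (Fin k) ℝ) :
    ∃ κ, 0 ≤ κ ∧ ∀ x, sqNorm (M *ᵥ x) ≤ κ * sqNorm x := by
  refine ⟨∑ i, ∑ j, M i j ^ 2, by positivity, fun x => ?_⟩
  simp only [sqNorm_eq, Finset.sum_mul]
  refine Finset.sum_le_sum fun i _ => ?_
  rw [← Finset.sum_mul]
  exact Finset.sum_mul_sq_le_sq_mul_sq Finset.univ (M i) x

theorem Matrix.PosDef.exists_le_dotProduct {k : ℕ} {M : Matrix (Fin k) (Fin k) ℝ}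
    (hM : M.PosDef) : ∃ r, 0 < r ∧ ∀ x, r * sqNorm x ≤ x ⬝ᵥ M *ᵥ x := by
  have hcont : Continuous fun x : Fin k → ℝ => x ⬝ᵥ M *ᵥ x := by fun_prop
  rcases (Metric.sphere (0 : Fin k → ℝ) 1).eq_empty_or_nonempty with he | hne
  · refine ⟨1, one_pos, fun x => ?_⟩
    have hx : x = 0 := by
      by_contra hx
      have : ‖x‖⁻¹ • x ∈ Metric.sphere (0 : Fin k → ℝ) 1 := by
        simp [norm_smul, inv_mul_cancel₀ (norm_ne_zero_iff.2 hx)]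
      rw [he] at this
      exact this
    simp [hx, sqNorm]
  · obtain ⟨x₀, hx₀, hmin⟩ := (isCompact_sphere (0 : Fin k → ℝ) 1).exists_isMinOn hne
      hcont.continuousOn
    have hx0 : x₀ ≠ 0 := by
      rintro rfl
      simp at hx₀
    have hpos : 0 < x₀ ⬝ᵥ M *ᵥ x₀ := by simpa using hM.dotProduct_mulVec_pos hx0
    refine ⟨(x₀ ⬝ᵥ M *ᵥ x₀) / (k + 1), by positivity, fun x => ?_⟩
    rcases eq_or_ne x 0 with rfl | hx
    · simp [sqNorm]
    have hn := norm_ne_zero_iff.2 hx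
    have h1 : x₀ ⬝ᵥ M *ᵥ x₀ ≤ (‖x‖⁻¹ • x) ⬝ᵥ M *ᵥ (‖x‖⁻¹ • x) :=
      hmin (by simp [norm_smul, inv_mul_cancel₀ hn])
    rw [mulVec_smul, dotProduct_smul, smul_dotProduct, smul_eq_mul, smul_eq_mul] at h1
    have h2 : (x₀ ⬝ᵥ M *ᵥ x₀) * ‖x‖ ^ 2 ≤ x ⬝ᵥ M *ᵥ x := by
      have := mul_le_mul_of_nonneg_right h1 (sq_nonneg ‖x‖)
      calc _ ≤ _ := this
        _ = x ⬝ᵥ M *ᵥ x := by field_simp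
    have h3 := sqNorm_le_card_mul_norm_sq x
    have h4 : sqNorm x ≤ (k + 1) * ‖x‖ ^ 2 := by nlinarith [sq_nonneg ‖x‖]
    calc _ ≤ (x₀ ⬝ᵥ M *ᵥ x₀) / (k + 1) * ((k + 1) * ‖x‖ ^ 2) := by gcongr
      _ = (x₀ ⬝ᵥ M *ᵥ x₀) * ‖x‖ ^ 2 := by field_simp
      _ ≤ _ := h2

theorem exists_dotProduct_mulVec_le {k : ℕ} (M : Matrix (Fin k) (Fin k) ℝ) :
    ∃ r, 0 < r ∧ ∀ x, x ⬝ᵥ M *ᵥ x ≤ r * sqNorm x := by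
  obtain ⟨κ, hκ, h⟩ := exists_sqNorm_mulVec_le M
  refine ⟨1 + κ, by positivity, fun x => ?_⟩
  have := two_mul_dotProduct_le x (M *ᵥ x)
  have := h x
  nlinarith [sqNorm_nonneg x, sqNorm_nonneg (M *ᵥ x)]

/-- The dissipation inequality behind both Lyapunov arguments: by the Riccati equation, the
feedback `-Bᵀ P` with an error `ε` in the measured state and a perturbation `u` of the input
dissipates `x ⬝ᵥ P *ᵥ x`. -/
theorem riccati_dissipation {d m : ℕ} {A P R₁ : Matrix (Fin d) (Fin d) ℝ}
    {B : Matrix (Fin d) (Fin m) ℝ} {K : Matrix (Fin m) (Fin d) ℝ}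
    (hP : P.IsHermitian) (hare : P * A + Aᵀ * P - P * B * Bᵀ * P + R₁ = 0)
    (hK : K = -(Bᵀ * P)) (x ε : Fin d → ℝ) (u : Fin m → ℝ) :
    (A *ᵥ x + B *ᵥ (K *ᵥ (x + ε) + u)) ⬝ᵥ P *ᵥ x +
      x ⬝ᵥ P *ᵥ (A *ᵥ x + B *ᵥ (K *ᵥ (x + ε) + u)) ≤
      -(x ⬝ᵥ R₁ *ᵥ x) + 2 * sqNorm (K *ᵥ ε) + 2 * sqNorm u := by
  have hPt : Pᵀ = P := by rw [← conjTranspose_eq_transpose_of_trivial]; exact hP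
  have hsym : ∀ a b : Fin d → ℝ, a ⬝ᵥ P *ᵥ b = b ⬝ᵥ P *ᵥ a := by
    intro a b
    rw [dotProduct_mulVec, ← mulVec_transpose, hPt, dotProduct_comm]
  have hB : ∀ v : Fin m → ℝ, (B *ᵥ v) ⬝ᵥ P *ᵥ x = -(v ⬝ᵥ K *ᵥ x) := by
    intro v
    rw [hK, neg_mulVec, dotProduct_neg, neg_neg, ← mulVec_mulVec, dotProduct_comm,
      dotProduct_mulVec, ← mulVec_transpose, dotProduct_comm]
  have hA : x ⬝ᵥ (P * A) *ᵥ x + x ⬝ᵥ (Aᵀ * P) *ᵥ x - x ⬝ᵥ (P * B * Bᵀ * P) *ᵥ x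
      + x ⬝ᵥ R₁ *ᵥ x = 0 := by
    rw [← dotProduct_add, ← add_mulVec, ← dotProduct_sub, ← sub_mulVec, ← dotProduct_add,
      ← add_mulVec, hare]
    simp
  have h1 : x ⬝ᵥ (Aᵀ * P) *ᵥ x = (A *ᵥ x) ⬝ᵥ P *ᵥ x := by
    rw [← mulVec_mulVec, dotProduct_mulVec, vecMul_transpose]
  have h2 : x ⬝ᵥ (P * A) *ᵥ x = (A *ᵥ x) ⬝ᵥ P *ᵥ x := by
    rw [← mulVec_mulVec, hsym]
  have h3 : x ⬝ᵥ (P * B * Bᵀ * P) *ᵥ x = sqNorm (K *ᵥ x) := by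
    have : P * B * Bᵀ * P = (Bᵀ * P)ᵀ * (Bᵀ * P) := by
      rw [transpose_mul, transpose_transpose, hPt, Matrix.mul_assoc (P * B)]
    rw [this, ← mulVec_mulVec, dotProduct_mulVec, vecMul_transpose, hK, neg_mulVec, sqNorm_neg]
    rfl
  rw [hsym x, add_dotProduct, hB]
  have h4 := two_mul_dotProduct_le (-(K *ᵥ x)) (K *ᵥ ε + u)
  have h5 := sqNorm_add_le (K *ᵥ ε) u
  rw [sqNorm_neg, neg_dotProduct, dotProduct_comm] at h4
  have h6 : (K *ᵥ (x + ε) + u) ⬝ᵥ K *ᵥ x = sqNorm (K *ᵥ x) + (K *ᵥ ε + u) ⬝ᵥ K *ᵥ x := by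
    rw [mulVec_add, add_assoc, add_dotProduct]; rfl
  rw [h6]
  linarith

/-! ### The stress matrix -/

section Stress

variable {nl nf d : ℕ} {G : SimpleGraph (Agent nl nf)} {w : Agent nl nf → Agent nl nf → ℝ}

theorem stressMatrix_apply (hw : ∀ i j, ¬ G.Adj i j → w i j = 0) (i j : Agent nl nf) :
    stressMatrix G w i j = (if i = j then ∑ k, w i k else 0) - w i j := by
  classical
  have hsum : ∑ k ∈ neighbors G i, w i k = ∑ k, w i k := by
    refine Finset.sum_subset (Finset.subset_univ _) fun k _ hk => hw i k ?_
    simpa [neighbors] using hk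
  by_cases hij : i = j
  · subst hij
    simp [stressMatrix, hsum, hw i i (G.irrefl)]
  · by_cases hadj : G.Adj i j
    · simp [stressMatrix, hij, hadj]
    · simp [stressMatrix, hij, hadj, hw i j hadj]

/-- The rows of `(Ω ⊗ I) x` are the weighted sums of relative positions. -/
theorem sum_stressMatrix_smul (hw : ∀ i j, ¬ G.Adj i j → w i j = 0) {k : ℕ}
    (x : Agent nl nf → Fin k → ℝ) (i : Agent nl nf) :
    ∑ j, stressMatrix G w i j • x j = ∑ j, w i j • (x i - x j) := by
  simp only [stressMatrix_apply hw, sub_smul, ite_smul, zero_smul, Finset.sum_sub_distrib,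
    Finset.sum_ite_eq, Finset.mem_univ, if_true, smul_sub, Finset.sum_smul]

/-- If `M` is positive semidefinite, so is the block operator `M ⊗ I` on stacks of vectors. -/
theorem Matrix.PosSemidef.sum_dotProduct_nonneg {ι : Type*} [Fintype ι] {M : Matrix ι ι ℝ}
    (hM : M.PosSemidef) {k : ℕ} (x : ι → Fin k → ℝ) :
    0 ≤ ∑ i, x i ⬝ᵥ ∑ j, M i j • x j := by
  have h : ∑ i, x i ⬝ᵥ ∑ j, M i j • x j = ∑ l, (fun i => x i l) ⬝ᵥ M *ᵥ (fun i => x i l) := by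
    simp only [dotProduct, mulVec, Finset.sum_apply, Pi.smul_apply, smul_eq_mul]
    exact Finset.sum_comm
  rw [h]
  exact Finset.sum_nonneg fun l _ => by simpa using hM.dotProduct_mulVec_nonneg fun i => x i l

/-- An affine function that vanishes on an affinely spanning family is zero. -/
theorem eq_zero_of_affineSpan_eq_top {ι : Type*} {b : ι → Fin d → ℝ}
    (hb : affineSpan ℝ (Set.range b) = ⊤) {c : Fin d → ℝ} {β : ℝ}
    (h : ∀ i, c ⬝ᵥ b i + β = 0) : c = 0 ∧ β = 0 := by
  have hall : ∀ x : Fin d → ℝ, c ⬝ᵥ x + β = 0 := by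
    intro x
    have hx : x ∈ affineSpan ℝ (Set.range b) := by rw [hb]; trivial
    refine affineSpan_induction (p := fun x => c ⬝ᵥ x + β = 0) hx ?_ ?_
    · rintro _ ⟨i, rfl⟩
      exact h i
    · intro r u v w hu hv hw
      simp only [vsub_eq_sub, vadd_eq_add, dotProduct_add, dotProduct_smul, dotProduct_sub,
        smul_eq_mul]
      linear_combination r * hu - r * hv + hw
  have hβ : β = 0 := by simpa using hall 0
  refine ⟨?_, hβ⟩
  ext i
  simpa [hβ] using hall (Pi.single i 1)

/-- The kernel of a stress matrix of maximal rank `n - d - 1` consists of the affine functions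
of the nominal configuration. -/
theorem exists_affine_of_stressMatrix_mulVec_eq_zero {a : Agent nl nf → Fin d → ℝ}
    (hstress : IsEquilibriumStress G w a)
    (hspan : affineSpan ℝ (Set.range fun i : Fin nl => a (Sum.inl i)) = ⊤)
    (hrank : (stressMatrix G w).rank + d + 1 = nl + nf) {z : Agent nl nf → ℝ}
    (hz : stressMatrix G w *ᵥ z = 0) : ∃ (c : Fin d → ℝ) (β : ℝ), ∀ i, z i = c ⬝ᵥ a i + β := by
  let φ : (Fin d → ℝ) × ℝ →ₗ[ℝ] (Agent nl nf → ℝ) :=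
    { toFun := fun x i => x.1 ⬝ᵥ a i + x.2
      map_add' := fun x y => by ext i; simp [add_dotProduct]; ring
      map_smul' := fun r x => by ext i; simp [smul_dotProduct]; ring }
  have hφ : Function.Injective φ := by
    rw [← LinearMap.ker_eq_bot, LinearMap.ker_eq_bot']
    rintro ⟨c, β⟩ h
    have := eq_zero_of_affineSpan_eq_top hspan (c := c) (β := β)
      fun i => congrFun h (Sum.inl i)
    simp [this.1, this.2]
  have hle : LinearMap.range φ ≤ LinearMap.ker (stressMatrix G w).mulVecLin := by
    rintro _ ⟨⟨c, β⟩, rfl⟩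
    rw [LinearMap.mem_ker, mulVecLin_apply]
    ext i
    have h1 : ∑ j, stressMatrix G w i j • a j = 0 := by
      ext l
      have := congrFun hstress.equilibrium (i, l)
      simpa [mulVec, dotProduct, Fintype.sum_prod_type, kroneckerMap_apply, one_apply,
        Finset.sum_apply] using this
    have h2 : ∑ j, stressMatrix G w i j = 0 := by
      simpa using congrFun (sum_stressMatrix_smul hstress.support
        (fun _ : Agent nl nf => fun _ : Fin 1 => (1 : ℝ)) i) 0
    have h3 : ∑ j, stressMatrix G w i j * (c ⬝ᵥ a j) = c ⬝ᵥ ∑ j, stressMatrix G w i j • a j := by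
      simp [dotProduct_sum, dotProduct_smul]
    change ∑ j, stressMatrix G w i j * (c ⬝ᵥ a j + β) = 0
    simp only [mul_add, Finset.sum_add_distrib, ← Finset.sum_mul]
    rw [h3, h1, h2]
    simp
  have hfin : Module.finrank ℝ (LinearMap.range φ) =
      Module.finrank ℝ (LinearMap.ker (stressMatrix G w).mulVecLin) := by
    rw [LinearMap.finrank_range_of_inj hφ]
    have h1 := LinearMap.finrank_range_add_finrank_ker (stressMatrix G w).mulVecLin
    rw [← Matrix.rank] at h1
    simp only [Module.finrank_fintype_fun_eq_card, Fintype.card_sum, Fintype.card_fin,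
      Module.finrank_prod, Module.finrank_self] at h1 ⊢
    omega
  have hmem : z ∈ LinearMap.range φ := by
    rw [Submodule.eq_of_le_of_finrank_eq hle hfin]
    simpa using hz
  obtain ⟨⟨c, β⟩, rfl⟩ := hmem
  exact ⟨c, β, fun i => rfl⟩

/-- The follower block of the stress matrix is invertible: a vector that it annihilates extends by
zero to the kernel of `Ω`, hence is affine in the configuration, and it vanishes on the leaders. -/
theorem isUnit_det_stressMatrix_toBlocks₂₂ {a : Agent nl nf → Fin d → ℝ}
    (hstress : IsEquilibriumStress G w a)
    (hspan : affineSpan ℝ (Set.range fun i : Fin nl => a (Sum.inl i)) = ⊤)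
    (hpsd : (stressMatrix G w).PosSemidef)
    (hrank : (stressMatrix G w).rank + d + 1 = nl + nf) :
    IsUnit (stressMatrix G w).toBlocks₂₂.det := by
  rw [isUnit_iff_ne_zero]
  intro hdet
  obtain ⟨v, hv0, hv⟩ := exists_mulVec_eq_zero_iff.2 hdet
  have hquad : Sum.elim (0 : Fin nl → ℝ) v ⬝ᵥ stressMatrix G w *ᵥ Sum.elim 0 v = 0 := by
    have h1 : ∀ i, ∑ j, stressMatrix G w (Sum.inr i) (Sum.inr j) * v j = 0 :=
      fun i => congrFun hv i
    simp [dotProduct, mulVec, Fintype.sum_sum_type, h1]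
  obtain ⟨c, β, h⟩ := exists_affine_of_stressMatrix_mulVec_eq_zero hstress hspan hrank
    ((hpsd.dotProduct_mulVec_zero_iff _).1 (by simpa using hquad))
  obtain ⟨rfl, rfl⟩ := eq_zero_of_affineSpan_eq_top hspan fun i => (h (Sum.inl i)).symm
  refine hv0 (funext fun i => ?_)
  simpa using h (Sum.inr i)

/-- The deviation from the affine formation is `Ω_ff⁻¹` applied to the rows `ξ` of
`(Ω ⊗ I) x` that belong to the followers. -/
theorem formation_error_eq (M : Matrix (Agent nl nf) (Agent nl nf) ℝ)
    (hM : IsUnit M.toBlocks₂₂.det) (x : Agent nl nf → Fin d → ℝ) :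
    (fun q : Fin nf × Fin d => x (Sum.inr q.1) q.2) +
      ((M.toBlocks₂₂⁻¹ * M.toBlocks₂₁) ⊗ₖ (1 : Matrix (Fin d) (Fin d) ℝ)) *ᵥ
        (fun q : Fin nl × Fin d => x (Sum.inl q.1) q.2) =
    fun q => ∑ i, M.toBlocks₂₂⁻¹ q.1 i * (∑ j, M (Sum.inr i) j • x j) q.2 := by
  ext ⟨i, l⟩
  have h1 : (fun i => (∑ j, M (Sum.inr i) j • x j) l) =
      M.toBlocks₂₁ *ᵥ (fun j => x (Sum.inl j) l) + M.toBlocks₂₂ *ᵥ (fun j => x (Sum.inr j) l) := by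
    ext i
    simp [Fintype.sum_sum_type, mulVec, dotProduct, toBlocks₂₁, toBlocks₂₂, Finset.sum_apply]
  have h2 : ∑ i', M.toBlocks₂₂⁻¹ i i' * (∑ j, M (Sum.inr i') j • x j) l =
      (M.toBlocks₂₂⁻¹ *ᵥ (fun i => (∑ j, M (Sum.inr i) j • x j) l)) i := rfl
  change _ = ∑ i', M.toBlocks₂₂⁻¹ i i' * (∑ j, M (Sum.inr i') j • x j) l
  rw [h2, h1, mulVec_add, mulVec_mulVec, mulVec_mulVec, nonsing_inv_mul _ hM, one_mulVec]
  simp [mulVec, dotProduct, Fintype.sum_prod_type, kroneckerMap_apply, one_apply, add_comm]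

end Stress

/-! ### The time domain of an evolution -/

/-- The times `0 ≤ t < horizon` at which the closed loop evolves. -/
def Evolution.domain {nl nf d m : ℕ} (e : Evolution nl nf d m) : Set ℝ :=
  {t : ℝ | 0 ≤ t ∧ (t : EReal) < e.horizon}

section Domain

variable {nl nf d m : ℕ} {S : Scheme nl nf d m} {e : Evolution nl nf d m}

theorem Evolution.ordConnected_domain : e.domain.OrdConnected := by
  refine ⟨fun s hs t ht x hx => ⟨hs.1.trans hx.1, lt_of_le_of_lt ?_ ht.2⟩⟩
  exact_mod_cast hx.2

theorem Evolution.domain_eq_Ici (h : e.horizon = ⊤) : e.domain = Set.Ici 0 := by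
  ext t
  simp [domain, h, EReal.coe_lt_top]

theorem IsEvolution.τ_le_succ (he : IsEvolution S e) (i : Agent nl nf) (k : ℕ) :
    e.τ i k ≤ e.τ i (k + 1) := by
  by_cases h : e.τ i k = ⊤
  · rw [h, he.τ_top i k h]
  · exact (he.τ_lt i k h).le

theorem IsEvolution.τ_nonneg (he : IsEvolution S e) (i : Agent nl nf) (k : ℕ) : 0 ≤ e.τ i k := by
  rw [← he.τ_zero i]
  exact monotone_nat_of_le_succ (he.τ_le_succ i) (Nat.zero_le k)

theorem IsEvolution.horizon_pos (he : IsEvolution S e) : 0 < e.horizon := by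
  rcases isEmpty_or_nonempty (Agent nl nf) with h | h
  · rw [Evolution.horizon, iInf_of_empty]
    exact EReal.zero_lt_top
  · obtain ⟨i, hi⟩ := exists_eq_ciInf_of_finite (f := fun i => ⨆ k, e.τ i k)
    rw [Evolution.horizon, ← hi]
    have h0 := he.τ_lt i 0 (by rw [he.τ_zero]; exact EReal.zero_ne_top)
    rw [he.τ_zero] at h0
    exact h0.trans_le (le_iSup (e.τ i) (0 + 1))

theorem IsEvolution.zero_mem (he : IsEvolution S e) : (0 : ℝ) ∈ e.domain :=
  ⟨le_rfl, by simpa using he.horizon_pos⟩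

theorem IsEvolution.exists_holds (he : IsEvolution S e) {t : ℝ} (ht : t ∈ e.domain) :
    ∃ σ, e.Holds σ t := by
  classical
  have h : ∀ j, ∃ k, e.τ j k ≤ (t : EReal) ∧ (t : EReal) < e.τ j (k + 1) := by
    intro j
    have h1 : ∃ k, (t : EReal) < e.τ j k :=
      lt_iSup_iff.1 (ht.2.trans_le (iInf_le (fun i => ⨆ k, e.τ i k) j))
    have h2 := Nat.find_spec h1
    obtain ⟨k, hk⟩ : ∃ k, Nat.find h1 = k + 1 := by
      refine Nat.exists_eq_succ_of_ne_zero fun h0 => ?_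
      rw [h0, he.τ_zero] at h2
      exact absurd ht.1 (not_le.2 (by exact_mod_cast h2))
    refine ⟨k, not_lt.1 (Nat.find_min h1 (by omega)), hk ▸ h2⟩
  choose σ hσ using h
  exact ⟨σ, hσ⟩

theorem IsEvolution.toReal_τ_mem (he : IsEvolution S e) {t : ℝ} (ht : t ∈ e.domain)
    {i : Agent nl nf} {k : ℕ} (h : e.τ i k ≤ (t : EReal)) :
    (e.τ i k).toReal ∈ e.domain ∧ (e.τ i k).toReal ≤ t := by
  have h0 := he.τ_nonneg i k
  have hcoe : ((e.τ i k).toReal : EReal) = e.τ i k :=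
    EReal.coe_toReal (ne_top_of_le_ne_top (EReal.coe_ne_top t) h)
      (ne_bot_of_le_ne_bot EReal.zero_ne_bot h0)
  refine ⟨⟨EReal.toReal_nonneg h0, ?_⟩, ?_⟩
  · rw [hcoe]; exact h.trans_lt ht.2
  · rw [← hcoe] at h; exact_mod_cast h

theorem continuousOn_exp_neg_mul (ϖ : ℝ) {D : Set ℝ} :
    ContinuousOn (fun t : ℝ => Real.exp (-ϖ * t)) D := by fun_prop

theorem hasDerivWithinAt_exp_neg_mul (ϖ t : ℝ) :
    HasDerivWithinAt (fun t : ℝ => Real.exp (-ϖ * t)) (Real.exp (-ϖ * t) * -ϖ) (Set.Ici t) t := by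
  simpa using (((hasDerivAt_id t).const_mul (-ϖ)).exp).hasDerivWithinAt

theorem exists_common_bound {ι : Type*} [Fintype ι] {D : Set ℝ} {f : ι → ℝ → ℝ}
    (h : ∀ i, ∃ M, ∀ t ∈ D, f i t ≤ M) : ∃ M, 0 ≤ M ∧ ∀ i, ∀ t ∈ D, f i t ≤ M := by
  choose M hM using h
  refine ⟨∑ i, |M i|, by positivity, fun i t ht => (hM i t ht).trans ((le_abs_self _).trans ?_)⟩
  exact Finset.single_le_sum (f := fun i => |M i|) (fun _ _ => abs_nonneg _) (Finset.mem_univ i)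

theorem IsEvolution.γ_mono (he : IsEvolution S e) (i : Fin nl) {s t : ℝ} (hs : s ∈ e.domain)
    (ht : t ∈ e.domain) (hst : s ≤ t) : e.γ i s ≤ e.γ i t :=
  le_of_right_deriv_nonneg e.ordConnected_domain (he.continuous_γ i) (fun x hx => by
    obtain ⟨σ, hσ⟩ := he.exists_holds hx
    exact ⟨_, he.deriv_γ x σ hx.1 hσ i, sqNorm_nonneg _⟩) hs ht hst

theorem IsEvolution.coupling_mono (he : IsEvolution S e) (i : Fin nf) {s t : ℝ}
    (hs : s ∈ e.domain) (ht : t ∈ e.domain) (hst : s ≤ t) : e.coupling i s ≤ e.coupling i t :=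
  le_of_right_deriv_nonneg e.ordConnected_domain (he.continuous_coupling i) (fun x hx => by
    obtain ⟨σ, hσ⟩ := he.exists_holds hx
    exact ⟨_, he.deriv_coupling x σ hx.1 hσ i, sqNorm_nonneg _⟩) hs ht hst

theorem IsEvolution.one_lt_coupling (he : IsEvolution S e) (i : Fin nf) {t : ℝ}
    (ht : t ∈ e.domain) : 1 < e.coupling i t :=
  (he.init_coupling i).trans_le (he.coupling_mono i he.zero_mem ht ht.1)

theorem IsEvolution.varphi_mono (he : IsEvolution S e) (i : Fin nf) {s t : ℝ}
    (hs : s ∈ e.domain) (ht : t ∈ e.domain) (hst : s ≤ t) : e.varphi i s ≤ e.varphi i t :=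
  le_of_right_deriv_nonneg e.ordConnected_domain (he.continuous_varphi i) (fun x hx => by
    obtain ⟨σ, hσ⟩ := he.exists_holds hx
    exact ⟨_, he.deriv_varphi x σ hx.1 hσ i, sqNorm_nonneg _⟩) hs ht hst

theorem IsEvolution.phi_mono (he : IsEvolution S e) (i : Fin nf) {s t : ℝ}
    (hs : s ∈ e.domain) (ht : t ∈ e.domain) (hst : s ≤ t) : e.phi i s ≤ e.phi i t :=
  le_of_right_deriv_nonneg e.ordConnected_domain (he.continuous_phi i) (fun x hx => by
    obtain ⟨σ, hσ⟩ := he.exists_holds hx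
    exact ⟨_, he.deriv_phi x σ hx.1 hσ i,
      mul_nonneg (zero_le_one.trans (he.one_lt_coupling i hx).le) (sqNorm_nonneg _)⟩) hs ht hst

end Domain

/-! ### The leaders -/

section Leaders

variable {nl nf d m : ℕ} {S : Scheme nl nf d m} {e : Evolution nl nf d m}
  {P R₁ : Matrix (Fin d) (Fin d) ℝ}

/-- The target error of a leader obeys a closed loop perturbed by its measurement error. -/
theorem IsEvolution.deriv_leader (he : IsEvolution S e)
    (hv : ∀ i, (S.A + S.B * S.K) *ᵥ S.pStar i + S.B *ᵥ S.v i = 0) {t : ℝ}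
    {σ : Agent nl nf → ℕ} (ht : 0 ≤ t) (hσ : e.Holds σ t) (i : Fin nl) :
    HasDerivWithinAt (fun t => e.p (Sum.inl i) t - S.pStar i)
      (S.A *ᵥ (e.p (Sum.inl i) t - S.pStar i) +
        S.B *ᵥ (S.K *ᵥ ((e.p (Sum.inl i) t - S.pStar i) + e.errP σ t (Sum.inl i)) + 0))
      (Set.Ici t) t := by
  refine ((he.deriv_p t σ ht hσ (Sum.inl i)).sub_const _).congr_deriv ?_
  have h := hv i
  have h2 : (e.p (Sum.inl i) t - S.pStar i) + e.errP σ t (Sum.inl i) =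
      e.pHat σ (Sum.inl i) - S.pStar i := by
    simp [Evolution.errP]
  rw [h2, ← sub_eq_zero, ← h]
  simp only [Evolution.input, mulVec_add, mulVec_sub, add_mulVec, ← mulVec_mulVec, mulVec_zero]
  abel

theorem IsEvolution.continuousOn_quadratic_leader (he : IsEvolution S e) (i : Fin nl) :
    ContinuousOn (fun t => (e.p (Sum.inl i) t - S.pStar i) ⬝ᵥ
      P *ᵥ (e.p (Sum.inl i) t - S.pStar i)) e.domain :=
  have h : ContinuousOn (fun t => e.p (Sum.inl i) t - S.pStar i) e.domain :=
    (he.continuous_p (Sum.inl i)).sub continuousOn_const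
  h.dotProduct (h.mulVec P)

/-- Adding a multiple of `(γ - c)² / 2` to the quadratic form of the Riccati equation, for a large
constant `c`, gives a function that is nonincreasing up to the integrable threshold; it bounds the
adaptive parameter and the target error. -/
theorem IsEvolution.leader_bounded (he : IsEvolution S e) (hP : P.PosDef) (hR₁ : R₁.PosDef)
    (hare : P * S.A + S.Aᵀ * P - P * S.B * S.Bᵀ * P + R₁ = 0) (hK : S.K = -(S.Bᵀ * P))
    (hv : ∀ i, (S.A + S.B * S.K) *ᵥ S.pStar i + S.B *ᵥ S.v i = 0)
    (hμ₁ : 0 < S.μ₁) (hϖ₁ : 0 < S.ϖ₁) (i : Fin nl) :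
    ∃ M, ∀ t ∈ e.domain, e.γ i t ≤ M ∧ sqNorm (e.p (Sum.inl i) t - S.pStar i) ≤ M := by
  obtain ⟨r, hr, hrle⟩ := hR₁.exists_le_dotProduct
  obtain ⟨ρ, hρ, hρle⟩ := hP.exists_le_dotProduct
  obtain ⟨κ, hκ, hκle⟩ := exists_sqNorm_mulVec_le S.K
  set x : ℝ → Fin d → ℝ := fun t => e.p (Sum.inl i) t - S.pStar i with hx
  -- `α r` pays for the `2 ‖x‖²` and `c` for the `(2 + 2 α κ) ‖ε‖²` in the derivative
  let α := 2 / r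
  let c := 2 + 2 * (α * κ)
  have hα : 0 < α := by positivity
  have hαr : α * r = 2 := div_mul_cancel₀ _ hr.ne'
  let W : ℝ → ℝ := fun t => α * (x t ⬝ᵥ P *ᵥ x t) + (e.γ i t - c) ^ 2 / 2 +
    S.μ₁ / S.ϖ₁ * Real.exp (-S.ϖ₁ * t)
  have hW : ∀ t ∈ e.domain, W t ≤ W 0 := by
    intro t ht
    refine le_of_right_deriv_nonpos e.ordConnected_domain ?_ ?_ he.zero_mem ht ht.1
    · have h1 := he.continuousOn_quadratic_leader (P := P) i
      have h2 := he.continuous_γ i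
      exact ((continuousOn_const.mul h1).add
        (((h2.sub continuousOn_const).pow 2).div_const 2)).add
        (continuousOn_const.mul (continuousOn_exp_neg_mul _))
    · intro t ht
      obtain ⟨σ, hσ⟩ := he.exists_holds ht
      have hx' := he.deriv_leader hv ht.1 hσ i
      have hγ' := he.deriv_γ t σ ht.1 hσ i
      refine ⟨_, (((hx'.dotProduct (hx'.mulVec P)).const_mul α).add
        (((hγ'.sub_const c).pow 2).div_const 2)).add
        ((hasDerivWithinAt_exp_neg_mul S.ϖ₁ t).const_mul (S.μ₁ / S.ϖ₁)), ?_⟩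
      have hdis := riccati_dissipation hP.isHermitian hare hK (x t) (e.errP σ t (Sum.inl i)) 0
      have htr := he.trigger_nonpos t σ ht.1 hσ (Sum.inl i)
      have h1 := hrle (x t)
      have h2 := hκle (e.errP σ t (Sum.inl i))
      have h3 : e.pHat σ (Sum.inl i) - S.pStar i = x t + e.errP σ t (Sum.inl i) := by
        simp [Evolution.errP, hx]
      simp only [Evolution.trigger, h3] at htr
      have h4 := sqNorm_add_le (x t) (e.errP σ t (Sum.inl i))
      have h5 : S.μ₁ / S.ϖ₁ * (Real.exp (-S.ϖ₁ * t) * -S.ϖ₁) =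
          -(S.μ₁ * Real.exp (-S.ϖ₁ * t)) := by field_simp
      have h6 : sqNorm (0 : Fin m → ℝ) = 0 := by simp [sqNorm]
      rw [h6] at hdis
      have h7 := mul_le_mul_of_nonneg_left (hdis.trans
        (show _ ≤ -(r * sqNorm (x t)) + 2 * (κ * sqNorm (e.errP σ t (Sum.inl i))) by linarith))
        hα.le
      have h8 : α * (-(r * sqNorm (x t)) + 2 * (κ * sqNorm (e.errP σ t (Sum.inl i)))) =
          -(2 * sqNorm (x t)) + 2 * (α * κ) * sqNorm (e.errP σ t (Sum.inl i)) := by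
        rw [← hαr]; ring
      rw [h8] at h7
      rw [h5]
      simp only [Nat.cast_ofNat, Nat.add_one_sub_one, pow_one]
      have h9 : (2 + 2 * (α * κ)) * sqNorm (e.errP σ t (Sum.inl i)) =
        c * sqNorm (e.errP σ t (Sum.inl i)) := rfl
      linarith
  have hρ0 : ∀ t, 0 ≤ x t ⬝ᵥ P *ᵥ x t := fun t =>
    (mul_nonneg hρ.le (sqNorm_nonneg _)).trans (hρle _)
  refine ⟨max (c + W 0 + 1) (W 0 / (α * ρ)), fun t ht => ?_⟩
  have h1 := hW t ht
  have h2 : W t = α * (x t ⬝ᵥ P *ᵥ x t) + (e.γ i t - c) ^ 2 / 2 +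
    S.μ₁ / S.ϖ₁ * Real.exp (-S.ϖ₁ * t) := rfl
  have h3 : 0 ≤ S.μ₁ / S.ϖ₁ * Real.exp (-S.ϖ₁ * t) := by positivity
  have h4 := mul_nonneg hα.le (hρ0 t)
  refine ⟨le_max_of_le_left ?_, le_max_of_le_right ?_⟩
  · nlinarith [sq_nonneg (e.γ i t - c - 1)]
  · rw [le_div_iff₀ (by positivity)]
    have h5 := mul_le_mul_of_nonneg_left (hρle (x t)) hα.le
    have h6 := sq_nonneg (e.γ i t - c)
    have h7 : sqNorm (x t) * (α * ρ) = α * (ρ * sqNorm (x t)) := by ring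
    rw [h7]
    linarith

/-- Once the evolution is global, the quadratic form decays exponentially up to `‖ε‖² = γ̇`, which
is integrable since `γ` is bounded. -/
theorem IsEvolution.leader_tendsto (he : IsEvolution S e) (hP : P.PosDef) (hR₁ : R₁.PosDef)
    (hare : P * S.A + S.Aᵀ * P - P * S.B * S.Bᵀ * P + R₁ = 0) (hK : S.K = -(S.Bᵀ * P))
    (hv : ∀ i, (S.A + S.B * S.K) *ᵥ S.pStar i + S.B *ᵥ S.v i = 0)
    (htop : e.horizon = ⊤) {M : ℝ} (i : Fin nl) (hM : ∀ t ∈ e.domain, e.γ i t ≤ M) :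
    Tendsto (fun t => e.p (Sum.inl i) t - S.pStar i) atTop (𝓝 0) := by
  obtain ⟨r, hr, hrle⟩ := hR₁.exists_le_dotProduct
  obtain ⟨ρ, hρ, hρle⟩ := hP.exists_le_dotProduct
  obtain ⟨ρ', hρ', hρ'le⟩ := exists_dotProduct_mulVec_le P
  obtain ⟨κ, hκ, hκle⟩ := exists_sqNorm_mulVec_le S.K
  have hD := e.domain_eq_Ici htop
  have hmem : ∀ t, 0 ≤ t → t ∈ e.domain := fun t ht => hD ▸ ht
  have hV := tendsto_zero_of_right_deriv_le
    (f := fun t => (e.p (Sum.inl i) t - S.pStar i) ⬝ᵥ P *ᵥ (e.p (Sum.inl i) t - S.pStar i))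
    (g := fun t => 2 * κ * e.γ i t) (δ := r / ρ') (M := 2 * κ * M) (by positivity)
    (hD ▸ he.continuousOn_quadratic_leader i)
    (hD ▸ continuousOn_const.mul (he.continuous_γ i))
    (fun t _ => (mul_nonneg hρ.le (sqNorm_nonneg _)).trans (hρle _))
    (fun s t hs hst => mul_le_mul_of_nonneg_left
      (he.γ_mono i (hmem s hs) (hmem t (hs.trans hst)) hst) (by positivity))
    (fun t ht => mul_le_mul_of_nonneg_left (hM t (hmem t ht)) (by positivity))
    (fun t ht => by
      obtain ⟨σ, hσ⟩ := he.exists_holds (hmem t ht)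
      have hx' := he.deriv_leader hv ht hσ i
      refine ⟨_, _, hx'.dotProduct (hx'.mulVec P),
        (he.deriv_γ t σ ht hσ i).const_mul (2 * κ), ?_⟩
      refine (riccati_dissipation hP.isHermitian hare hK _ _ 0).trans ?_
      have h1 := hrle (e.p (Sum.inl i) t - S.pStar i)
      have h2 := hκle (e.errP σ t (Sum.inl i))
      have h3 := hρ'le (e.p (Sum.inl i) t - S.pStar i)
      have h4 : sqNorm (0 : Fin m → ℝ) = 0 := by simp [sqNorm]
      have h5 := mul_le_mul_of_nonneg_left h3 (show 0 ≤ r / ρ' by positivity)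
      have h6 : r / ρ' * (ρ' * sqNorm (e.p (Sum.inl i) t - S.pStar i)) =
        r * sqNorm (e.p (Sum.inl i) t - S.pStar i) := by field_simp
      rw [h6] at h5
      rw [h4]
      linarith)
  have hV' := hV.const_mul ρ⁻¹
  rw [mul_zero] at hV'
  refine tendsto_zero_of_sqNorm (squeeze_zero (fun _ => sqNorm_nonneg _) (fun t => ?_) hV')
  rw [← div_eq_inv_mul, le_div_iff₀ hρ, mul_comm]
  exact hρle _

end Leaders

/-! ### The followers -/

section Followers

variable {nl nf d m : ℕ} {S : Scheme nl nf d m} {e : Evolution nl nf d m}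
  {P R₁ : Matrix (Fin d) (Fin d) ℝ}

/-- The combined states `ξ_i = ∑ j, Ω i j p_j`. -/
noncomputable def Evolution.xi (e : Evolution nl nf d m) (S : Scheme nl nf d m)
    (i : Agent nl nf) (t : ℝ) : Fin d → ℝ :=
  ∑ j, stressMatrix S.G S.w i j • e.p j t

/-- The compensation inputs of all agents, constantly `v_i` for the leaders and the estimate `y_i`
for the followers. -/
def Evolution.comp (e : Evolution nl nf d m) (S : Scheme nl nf d m) (t : ℝ) :
    Agent nl nf → Fin m → ℝ :=
  Sum.elim S.v fun i => e.y i t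

/-- The compensation errors of all agents, which vanish for the leaders. -/
def Evolution.compErr (e : Evolution nl nf d m) (σ : Agent nl nf → ℕ) (t : ℝ) :
    Agent nl nf → Fin m → ℝ :=
  Sum.elim 0 fun i => e.errY σ t i

/-- The combined compensations `θ_i = ∑ j, Ω i j Y_j`, where `Y` are the compensation inputs. -/
noncomputable def Evolution.theta (e : Evolution nl nf d m) (S : Scheme nl nf d m)
    (i : Agent nl nf) (t : ℝ) : Fin m → ℝ :=
  ∑ j, stressMatrix S.G S.w i j • e.comp S t j

theorem sum_sqNorm_followers_le (M : Matrix (Agent nl nf) (Agent nl nf) ℝ) {k : ℕ}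
    (x : Agent nl nf → Fin k → ℝ) :
    ∑ i : Fin nf, sqNorm (∑ j, M (Sum.inr i) j • x j) ≤
      (∑ i, ∑ j, M i j ^ 2) * ∑ j, sqNorm (x j) := by
  calc ∑ i : Fin nf, sqNorm (∑ j, M (Sum.inr i) j • x j)
      ≤ ∑ i, sqNorm (∑ j, M i j • x j) := by
        rw [Fintype.sum_sum_type (fun i => sqNorm (∑ j, M i j • x j))]
        exact le_add_of_nonneg_left (Finset.sum_nonneg fun _ _ => sqNorm_nonneg _)
    _ ≤ _ := by
        rw [Finset.sum_mul]
        exact Finset.sum_le_sum fun i _ => sqNorm_sum_smul_le _ _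

theorem xiHat_eq (hw : ∀ i j, ¬ S.G.Adj i j → S.w i j = 0) (σ : Agent nl nf → ℕ)
    (i : Agent nl nf) :
    e.xiHat S σ i = ∑ j, stressMatrix S.G S.w i j • e.pHat σ j := by
  rw [sum_stressMatrix_smul hw, Evolution.xiHat]
  refine Finset.sum_subset (Finset.subset_univ _) fun j _ hj => ?_
  rw [hw i j (by simpa [neighbors] using hj), zero_smul]

theorem xiHat_eq_add (hw : ∀ i j, ¬ S.G.Adj i j → S.w i j = 0) (σ : Agent nl nf → ℕ) (t : ℝ)
    (i : Agent nl nf) :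
    e.xiHat S σ i = e.xi S i t + ∑ j, stressMatrix S.G S.w i j • e.errP σ t j := by
  rw [xiHat_eq hw, Evolution.xi, ← Finset.sum_add_distrib]
  simp [Evolution.errP, smul_sub]

theorem thetaHat_eq (hw : ∀ i j, ¬ S.G.Adj i j → S.w i j = 0) (σ : Agent nl nf → ℕ)
    (i : Fin nf) :
    e.thetaHat S σ i = ∑ j, stressMatrix S.G S.w (Sum.inr i) j •
      (Sum.elim S.v (e.yHat σ) : Agent nl nf → Fin m → ℝ) j := by
  rw [sum_stressMatrix_smul hw, Evolution.thetaHat, Fintype.sum_sum_type, add_comm]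
  rfl

theorem thetaHat_eq_add (hw : ∀ i j, ¬ S.G.Adj i j → S.w i j = 0) (σ : Agent nl nf → ℕ) (t : ℝ)
    (i : Fin nf) :
    e.thetaHat S σ i = e.theta S (Sum.inr i) t +
      ∑ j, stressMatrix S.G S.w (Sum.inr i) j • e.compErr σ t j := by
  rw [thetaHat_eq hw, Evolution.theta, ← Finset.sum_add_distrib]
  refine Finset.sum_congr rfl fun j _ => ?_
  rw [← smul_add]
  cases j <;> simp [Evolution.comp, Evolution.compErr, Evolution.errY]

theorem sum_smul_mulVec {ι : Type*} [Fintype ι] {k l : ℕ} (M : Matrix (Fin k) (Fin l) ℝ)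
    (c : ι → ℝ) (x : ι → Fin l → ℝ) : ∑ j, c j • M *ᵥ x j = M *ᵥ ∑ j, c j • x j := by
  simp only [← mulVecLin_apply, map_sum, map_smul]

/-- The combined states of the followers obey the nominal closed loop, perturbed by the
measurement errors and driven by `θ̂`. -/
theorem IsEvolution.deriv_xi (he : IsEvolution S e) (hw : ∀ i j, ¬ S.G.Adj i j → S.w i j = 0)
    {t : ℝ} {σ : Agent nl nf → ℕ} (ht : 0 ≤ t) (hσ : e.Holds σ t) (i : Fin nf) :
    HasDerivWithinAt (e.xi S (Sum.inr i))
      (S.A *ᵥ e.xi S (Sum.inr i) t + S.B *ᵥ (S.K *ᵥ (e.xi S (Sum.inr i) t +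
        ∑ j, stressMatrix S.G S.w (Sum.inr i) j • e.errP σ t j) + e.thetaHat S σ i))
      (Set.Ici t) t := by
  have hinput : ∀ j, e.input S σ j = S.K *ᵥ e.pHat σ j +
      (Sum.elim S.v (e.yHat σ) : Agent nl nf → Fin m → ℝ) j := by
    rintro (j | j) <;> rfl
  refine (HasDerivWithinAt.fun_sum (u := Finset.univ) fun j _ =>
    (he.deriv_p t σ ht hσ j).const_smul (stressMatrix S.G S.w (Sum.inr i) j)).congr_deriv ?_
  rw [← xiHat_eq_add hw, xiHat_eq hw, thetaHat_eq hw]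
  simp only [hinput, smul_add, Finset.sum_add_distrib, sum_smul_mulVec, Evolution.xi]

theorem IsEvolution.continuousOn_xi (he : IsEvolution S e) (i : Agent nl nf) :
    ContinuousOn (e.xi S i) e.domain :=
  continuousOn_finsetSum _ fun j _ => (he.continuous_p j).fun_const_smul _

theorem IsEvolution.continuousOn_comp (he : IsEvolution S e) (i : Agent nl nf) :
    ContinuousOn (fun t => e.comp S t i) e.domain := by
  cases i with
  | inl i => exact continuousOn_const
  | inr i => exact he.continuous_y i

theorem IsEvolution.continuousOn_theta (he : IsEvolution S e) (i : Agent nl nf) :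
    ContinuousOn (e.theta S i) e.domain :=
  continuousOn_finsetSum _ fun j _ => (he.continuousOn_comp j).fun_const_smul _

/-- The energy `Yᵀ (Ω ⊗ I) Y` of the compensation inputs. -/
noncomputable def Evolution.energy (e : Evolution nl nf d m) (S : Scheme nl nf d m) (t : ℝ) : ℝ :=
  ∑ i, e.comp S t i ⬝ᵥ e.theta S i t

theorem IsEvolution.continuousOn_energy (he : IsEvolution S e) :
    ContinuousOn (e.energy S) e.domain :=
  continuousOn_finsetSum _ fun i _ => (he.continuousOn_comp i).dotProduct (he.continuousOn_theta i)

theorem sum_dotProduct_sum_smul_comm {ι : Type*} [Fintype ι] {M : Matrix ι ι ℝ}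
    (hM : ∀ i j, M i j = M j i) {k : ℕ} (x y : ι → Fin k → ℝ) :
    ∑ i, x i ⬝ᵥ ∑ j, M i j • y j = ∑ i, y i ⬝ᵥ ∑ j, M i j • x j := by
  simp only [dotProduct_sum, dotProduct_smul]
  rw [Finset.sum_comm]
  refine Finset.sum_congr rfl fun i _ => Finset.sum_congr rfl fun j _ => ?_
  rw [hM, dotProduct_comm]

theorem IsEvolution.deriv_energy (he : IsEvolution S e)
    (hsymm : ∀ i j, stressMatrix S.G S.w i j = stressMatrix S.G S.w j i)
    {t : ℝ} {σ : Agent nl nf → ℕ} (ht : 0 ≤ t) (hσ : e.Holds σ t) :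
    HasDerivWithinAt (e.energy S)
      (-(2 * ∑ i, e.coupling i t * (e.thetaHat S σ i ⬝ᵥ e.theta S (Sum.inr i) t)))
      (Set.Ici t) t := by
  let Y' : Agent nl nf → Fin m → ℝ :=
    Sum.elim 0 fun i => -(e.coupling i t • e.thetaHat S σ i)
  have hY : ∀ i, HasDerivWithinAt (fun t => e.comp S t i) (Y' i) (Set.Ici t) t := by
    rintro (i | i)
    · exact hasDerivWithinAt_const ..
    · exact he.deriv_y t σ ht hσ i
  have hθ : ∀ i, HasDerivWithinAt (e.theta S i) (∑ j, stressMatrix S.G S.w i j • Y' j)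
      (Set.Ici t) t := fun i => HasDerivWithinAt.fun_sum fun j _ => (hY j).fun_const_smul _
  refine (HasDerivWithinAt.fun_sum (u := Finset.univ) fun i _ =>
    (hY i).dotProduct (hθ i)).congr_deriv ?_
  rw [Finset.sum_add_distrib, sum_dotProduct_sum_smul_comm hsymm]
  change ∑ i, Y' i ⬝ᵥ e.theta S i t + ∑ i, Y' i ⬝ᵥ e.theta S i t = _
  rw [← two_mul, Fintype.sum_sum_type]
  simp [Y', neg_dotProduct, smul_dotProduct]

/-- The normalization `√(1 + ∑ d_i²)` of the energy. The summand `1` keeps it positive and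
differentiable also without followers. -/
noncomputable def Evolution.gainNorm (e : Evolution nl nf d m) (t : ℝ) : ℝ :=
  √(1 + ∑ i, e.coupling i t ^ 2)

theorem Evolution.gainNorm_pos (e : Evolution nl nf d m) (t : ℝ) : 0 < e.gainNorm t :=
  Real.sqrt_pos.2 (by positivity)

theorem Evolution.coupling_le_gainNorm (e : Evolution nl nf d m) (i : Fin nf) (t : ℝ) :
    e.coupling i t ≤ e.gainNorm t := by
  refine Real.le_sqrt_of_sq_le ?_
  have := Finset.single_le_sum (f := fun i => e.coupling i t ^ 2) (fun i _ => sq_nonneg _)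
    (Finset.mem_univ i)
  linarith

theorem IsEvolution.continuousOn_gainNorm (he : IsEvolution S e) :
    ContinuousOn e.gainNorm e.domain :=
  (continuousOn_const.add
    (continuousOn_finsetSum _ fun i _ => (he.continuous_coupling i).pow 2)).sqrt

theorem IsEvolution.deriv_gainNorm (he : IsEvolution S e)
    {t : ℝ} {σ : Agent nl nf → ℕ} (ht : 0 ≤ t) (hσ : e.Holds σ t) :
    HasDerivWithinAt e.gainNorm
      ((∑ i, e.coupling i t * sqNorm (e.thetaHat S σ i)) / e.gainNorm t) (Set.Ici t) t := by
  have h1 : HasDerivWithinAt (fun t => 1 + ∑ i, e.coupling i t ^ 2)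
      (∑ i, 2 * e.coupling i t * sqNorm (e.thetaHat S σ i)) (Set.Ici t) t := by
    refine ((HasDerivWithinAt.fun_sum (u := Finset.univ) fun i _ =>
      (he.deriv_coupling t σ ht hσ i).pow 2).const_add 1).congr_deriv ?_
    simp [sqNorm]
  refine (h1.sqrt (by positivity)).congr_deriv ?_
  have h2 := e.gainNorm_pos t
  change _ / (2 * e.gainNorm t) = _
  simp only [mul_assoc, ← Finset.mul_sum]
  field_simp

/-- Dividing the energy by the gain norm makes its dissipation the growth rate of the gain norm,
while the cross terms `d_i θ̂_i ⬝ ε_{y_j}` become bounded by `‖ε_{y_j}‖²` no matter how large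
`d_i / d_j` is. -/
theorem IsEvolution.deriv_energy_div_gainNorm (he : IsEvolution S e)
    (hstress : ∀ i j, ¬ S.G.Adj i j → S.w i j = 0)
    (hpsd : (stressMatrix S.G S.w).PosSemidef)
    {t : ℝ} {σ : Agent nl nf → ℕ} (ht : t ∈ e.domain) (hσ : e.Holds σ t) :
    ∃ c, HasDerivWithinAt (fun t => e.energy S t / e.gainNorm t) c (Set.Ici t) t ∧
      c ≤ -((∑ i, e.coupling i t * sqNorm (e.thetaHat S σ i)) / e.gainNorm t) +
        (∑ i, ∑ j, stressMatrix S.G S.w i j ^ 2) *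
          ∑ i, e.coupling i t * sqNorm (e.errY σ t i) := by
  have hsymm : ∀ i j, stressMatrix S.G S.w i j = stressMatrix S.G S.w j i := fun i j => by
    simpa using (hpsd.isHermitian.apply i j).symm
  have hE := he.deriv_energy hsymm ht.1 hσ
  have hg := he.deriv_gainNorm ht.1 hσ
  have hpos := e.gainNorm_pos t
  refine ⟨_, hE.div hg hpos.ne', ?_⟩
  have hd : ∀ i, 1 < e.coupling i t := fun i => he.one_lt_coupling i ht
  have hE0 : 0 ≤ e.energy S t := hpsd.sum_dotProduct_nonneg _
  set q := ∑ i, e.coupling i t * sqNorm (e.thetaHat S σ i) with hq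
  have hq0 : 0 ≤ q := Finset.sum_nonneg fun i _ =>
    mul_nonneg (zero_le_one.trans (hd i).le) (sqNorm_nonneg _)
  -- Young's inequality for the cross terms
  let ρ : Fin nf → Fin m → ℝ := fun i =>
    ∑ j, stressMatrix S.G S.w (Sum.inr i) j • e.compErr σ t j
  have hY : -(2 * ∑ i, e.coupling i t * (e.thetaHat S σ i ⬝ᵥ e.theta S (Sum.inr i) t)) ≤
      -q + ∑ i, e.coupling i t * sqNorm (ρ i) := by
    rw [hq, Finset.mul_sum, ← Finset.sum_neg_distrib, ← Finset.sum_neg_distrib,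
      ← Finset.sum_add_distrib]
    refine Finset.sum_le_sum fun i _ => ?_
    have h1 : e.theta S (Sum.inr i) t = e.thetaHat S σ i - ρ i :=
      eq_sub_of_add_eq (thetaHat_eq_add hstress σ t i).symm
    have h2 := two_mul_dotProduct_le (e.thetaHat S σ i) (ρ i)
    have h3 := mul_le_mul_of_nonneg_left h2 (zero_le_one.trans (hd i).le)
    rw [h1, dotProduct_sub]
    change -(2 * (_ * (sqNorm (e.thetaHat S σ i) - _))) ≤ _
    nlinarith
  have hρ : ∑ i, e.coupling i t * sqNorm (ρ i) ≤
      e.gainNorm t * ((∑ i, ∑ j, stressMatrix S.G S.w i j ^ 2) *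
        ∑ i, e.coupling i t * sqNorm (e.errY σ t i)) := by
    have h1 : ∑ j, sqNorm (e.compErr σ t j) ≤ ∑ i, e.coupling i t * sqNorm (e.errY σ t i) := by
      rw [Fintype.sum_sum_type]
      have h0 : ∑ i : Fin nl, sqNorm (e.compErr σ t (Sum.inl i)) = 0 := by
        simp [Evolution.compErr, sqNorm]
      rw [h0, zero_add]
      exact Finset.sum_le_sum fun i _ =>
        le_mul_of_one_le_left (sqNorm_nonneg _) (hd i).le
    calc ∑ i, e.coupling i t * sqNorm (ρ i)
        ≤ ∑ i, e.gainNorm t * sqNorm (ρ i) := Finset.sum_le_sum fun i _ =>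
          mul_le_mul_of_nonneg_right (e.coupling_le_gainNorm i t) (sqNorm_nonneg _)
      _ = e.gainNorm t * ∑ i, sqNorm (ρ i) := by rw [Finset.mul_sum]
      _ ≤ _ := mul_le_mul_of_nonneg_left ((sum_sqNorm_followers_le _ _).trans
          (mul_le_mul_of_nonneg_left h1 (by positivity))) hpos.le
  rw [div_le_iff₀ (by positivity)]
  have h3 : (-(q / e.gainNorm t) + (∑ i, ∑ j, stressMatrix S.G S.w i j ^ 2) *
      ∑ i, e.coupling i t * sqNorm (e.errY σ t i)) * e.gainNorm t ^ 2 =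
      (-q + e.gainNorm t * ((∑ i, ∑ j, stressMatrix S.G S.w i j ^ 2) *
        ∑ i, e.coupling i t * sqNorm (e.errY σ t i))) * e.gainNorm t := by
    field_simp
  rw [h3]
  have h4 : 0 ≤ e.energy S t * (q / e.gainNorm t) := by positivity
  have h5 := mul_le_mul_of_nonneg_right (hY.trans (add_le_add_right hρ (-q))) hpos.le
  linarith

end Followers

/-! ### Boundedness of the adaptive parameters of the followers -/

section Boundedness

variable {nl nf d m : ℕ} {S : Scheme nl nf d m} {e : Evolution nl nf d m}
  {P R₁ : Matrix (Fin d) (Fin d) ℝ}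

/-- The Lyapunov function `∑ ξ_iᵀ P ξ_i` of the combined states of the followers. -/
noncomputable def Evolution.xiEnergy (e : Evolution nl nf d m) (S : Scheme nl nf d m)
    (P : Matrix (Fin d) (Fin d) ℝ) (t : ℝ) : ℝ :=
  ∑ i : Fin nf, e.xi S (Sum.inr i) t ⬝ᵥ P *ᵥ e.xi S (Sum.inr i) t

theorem IsEvolution.continuousOn_xiEnergy (he : IsEvolution S e) :
    ContinuousOn (e.xiEnergy S P) e.domain :=
  continuousOn_finsetSum _ fun i _ =>
    (he.continuousOn_xi (Sum.inr i)).dotProduct ((he.continuousOn_xi (Sum.inr i)).mulVec P)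

theorem IsEvolution.deriv_xiEnergy (he : IsEvolution S e)
    (hw : ∀ i j, ¬ S.G.Adj i j → S.w i j = 0) (hP : P.IsHermitian)
    (hare : P * S.A + S.Aᵀ * P - P * S.B * S.Bᵀ * P + R₁ = 0) (hK : S.K = -(S.Bᵀ * P))
    {r κ : ℝ} (hr : ∀ x, r * sqNorm x ≤ x ⬝ᵥ R₁ *ᵥ x) (hκ0 : 0 ≤ κ)
    (hκ : ∀ x, sqNorm (S.K *ᵥ x) ≤ κ * sqNorm x)
    {t : ℝ} {σ : Agent nl nf → ℕ} (ht : 0 ≤ t) (hσ : e.Holds σ t) :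
    ∃ c, HasDerivWithinAt (e.xiEnergy S P) c (Set.Ici t) t ∧
      c ≤ -(r * ∑ i, sqNorm (e.xi S (Sum.inr i) t)) +
        2 * κ * ((∑ i, ∑ j, stressMatrix S.G S.w i j ^ 2) * ∑ j, sqNorm (e.errP σ t j)) +
        2 * ∑ i, sqNorm (e.thetaHat S σ i) := by
  refine ⟨_, HasDerivWithinAt.fun_sum fun i _ =>
    (he.deriv_xi hw ht hσ i).dotProduct ((he.deriv_xi hw ht hσ i).mulVec P), ?_⟩
  have h1 := mul_le_mul_of_nonneg_left
    (sum_sqNorm_followers_le (stressMatrix S.G S.w) (e.errP σ t)) (mul_nonneg zero_le_two hκ0)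
  refine (Finset.sum_le_sum fun i _ =>
    riccati_dissipation hP hare hK _ _ _).trans ?_
  refine le_trans ?_ (add_le_add_left (add_le_add_right h1 _) _)
  rw [Finset.mul_sum, Finset.mul_sum, Finset.mul_sum, ← Finset.sum_neg_distrib,
    ← Finset.sum_add_distrib, ← Finset.sum_add_distrib]
  refine Finset.sum_le_sum fun i _ => ?_
  have h2 := hr (e.xi S (Sum.inr i) t)
  have h3 := hκ (∑ j, stressMatrix S.G S.w (Sum.inr i) j • e.errP σ t j)
  linarith

/-- The functions `(phi_i - c)² / 2` and `(varphi_i - c)² / 2` dissipate arbitrarily large multiples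
`c` of the measurement errors, at a cost that the triggering rule bounds independently of `c`. -/
theorem IsEvolution.deriv_sum_sq_gains (he : IsEvolution S e)
    (hw : ∀ i j, ¬ S.G.Adj i j → S.w i j = 0) (c : ℝ)
    {t : ℝ} {σ : Agent nl nf → ℕ} (ht : 0 ≤ t) (hσ : e.Holds σ t) :
    ∃ c', HasDerivWithinAt
      (fun t => ∑ i, ((e.phi i t - c) ^ 2 / 2 + (e.varphi i t - c) ^ 2 / 2)) c' (Set.Ici t) t ∧
      c' ≤ 2 * ∑ i, sqNorm (e.xi S (Sum.inr i) t) +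
        2 * ((∑ i, ∑ j, stressMatrix S.G S.w i j ^ 2) * ∑ j, sqNorm (e.errP σ t j)) +
        ∑ i, sqNorm (e.thetaHat S σ i) + nf * S.μ₂ * Real.exp (-S.ϖ₂ * t) -
        c * ∑ i, sqNorm (e.errP σ t (Sum.inr i)) -
        c * ∑ i, e.coupling i t * sqNorm (e.errY σ t i) := by
  refine ⟨_, HasDerivWithinAt.fun_sum fun i _ =>
    ((((he.deriv_phi t σ ht hσ i).sub_const c).fun_pow 2).div_const 2).add
    ((((he.deriv_varphi t σ ht hσ i).sub_const c).fun_pow 2).div_const 2), ?_⟩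
  have h1 := mul_le_mul_of_nonneg_left
    (sum_sqNorm_followers_le (stressMatrix S.G S.w) (e.errP σ t)) zero_le_two
  have hn : (nf : ℝ) * S.μ₂ * Real.exp (-S.ϖ₂ * t) =
      ∑ _i : Fin nf, S.μ₂ * Real.exp (-S.ϖ₂ * t) := by simp [mul_assoc]
  rw [hn]
  refine le_trans ?_ (sub_le_sub_right (sub_le_sub_right (add_le_add_left (add_le_add_left
    (add_le_add_right h1 _) _) _) _) _)
  simp only [Finset.mul_sum, ← Finset.sum_add_distrib, ← Finset.sum_sub_distrib]
  refine Finset.sum_le_sum fun i _ => ?_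
  have htr := he.trigger_nonpos t σ ht hσ (Sum.inr i)
  have h2 := sqNorm_add_le (e.xi S (Sum.inr i) t)
    (∑ j, stressMatrix S.G S.w (Sum.inr i) j • e.errP σ t j)
  rw [← xiHat_eq_add hw] at h2
  simp only [Evolution.trigger] at htr
  simp only [Nat.cast_ofNat, Nat.add_one_sub_one, pow_one]
  linarith

/-- The total Lyapunov function adds to the normalized energy of the compensations small multiples
of the energy of the `ξ_i` and of `∑ ((phi_i - c)² + (varphi_i - c)²) / 2`. The terms in `θ̂` are paid for by the growth
of the gain norm, which the normalized energy dissipates; the leaders contribute their bounded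
parameters `γ_i`. -/
theorem IsEvolution.lyapunov_bounded (he : IsEvolution S e)
    (hw : ∀ i j, ¬ S.G.Adj i j → S.w i j = 0) (hpsd : (stressMatrix S.G S.w).PosSemidef)
    (hP : P.PosDef) (hR₁ : R₁.PosDef)
    (hare : P * S.A + S.Aᵀ * P - P * S.B * S.Bᵀ * P + R₁ = 0) (hK : S.K = -(S.Bᵀ * P))
    (hμ₂ : 0 < S.μ₂) (hϖ₂ : 0 < S.ϖ₂) {Mγ : ℝ} (hMγ : ∀ i, ∀ t ∈ e.domain, e.γ i t ≤ Mγ) :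
    ∃ δ δ' c N : ℝ, 0 < δ ∧ 0 < δ' ∧ ∀ t ∈ e.domain,
      e.gainNorm t / 2 + δ * e.xiEnergy S P t +
        δ' * ∑ i, ((e.phi i t - c) ^ 2 / 2 + (e.varphi i t - c) ^ 2 / 2) ≤ N := by
  obtain ⟨r, hr, hrle⟩ := hR₁.exists_le_dotProduct
  obtain ⟨κ, hκ, hκle⟩ := exists_sqNorm_mulVec_le S.K
  set C := ∑ i, ∑ j, stressMatrix S.G S.w i j ^ 2 with hC
  have hC0 : 0 ≤ C := by positivity
  -- `δ` weighs the energy of `ξ`, `δ'` the functions of the adaptive parameters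
  obtain ⟨δ, hδ, hδn⟩ : ∃ δ : ℝ, 0 < δ ∧ (2 * δ + δ * r / 2) * nf ≤ 1 / 2 := by
    refine ⟨1 / (2 * (2 + r / 2) * (nf + 1)), by positivity, ?_⟩
    have : (2 * (1 / (2 * (2 + r / 2) * (nf + 1))) + 1 / (2 * (2 + r / 2) * (nf + 1)) * r / 2) * nf
        = nf / (nf + 1) / 2 := by field_simp
    rw [this]
    have h : (nf : ℝ) / (nf + 1) ≤ 1 := (div_le_one (by positivity)).2 (by linarith)
    linarith
  set δ' := δ * r / 2 with hδ'
  have hδ'0 : 0 < δ' := by positivity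
  set β := δ * (2 * κ * C) + δ' * (2 * C) with hβ
  have hβ0 : 0 ≤ β := by positivity
  obtain ⟨c, hc⟩ : ∃ c, δ' * c = C + β := ⟨(C + β) / δ', by field_simp⟩
  let L : ℝ → ℝ := fun t => e.energy S t / e.gainNorm t + e.gainNorm t + δ * e.xiEnergy S P t +
    δ' * ∑ i, ((e.phi i t - c) ^ 2 / 2 + (e.varphi i t - c) ^ 2 / 2) - β * ∑ i, e.γ i t -
    (2 * δ + δ') * ∑ i, e.coupling i t +
    δ' * nf * S.μ₂ / S.ϖ₂ * Real.exp (-S.ϖ₂ * t)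
  have hL : ∀ t ∈ e.domain, L t ≤ L 0 := by
    intro t ht
    refine le_of_right_deriv_nonpos e.ordConnected_domain ?_ ?_ he.zero_mem ht ht.1
    · have h1 := he.continuousOn_energy.div he.continuousOn_gainNorm
        fun t _ => (e.gainNorm_pos t).ne'
      have h2 : ContinuousOn (fun t => ∑ i, ((e.phi i t - c) ^ 2 / 2 +
          (e.varphi i t - c) ^ 2 / 2)) e.domain :=
        continuousOn_finsetSum _ fun i _ =>
          ((((he.continuous_phi i).sub continuousOn_const).pow 2).div_const 2).add
          ((((he.continuous_varphi i).sub continuousOn_const).pow 2).div_const 2)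
      have h3 : ContinuousOn (fun t => ∑ i, e.γ i t) e.domain :=
        continuousOn_finsetSum _ fun i _ => he.continuous_γ i
      have h4 : ContinuousOn (fun t => ∑ i, e.coupling i t) e.domain :=
        continuousOn_finsetSum _ fun i _ => he.continuous_coupling i
      exact (((((h1.add he.continuousOn_gainNorm).add
        (continuousOn_const.mul he.continuousOn_xiEnergy)).add (continuousOn_const.mul h2)).sub
        (continuousOn_const.mul h3)).sub (continuousOn_const.mul h4)).add
        (continuousOn_const.mul (continuousOn_exp_neg_mul _))
    · intro t ht
      obtain ⟨σ, hσ⟩ := he.exists_holds ht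
      obtain ⟨v, hv, hvle⟩ := he.deriv_energy_div_gainNorm hw hpsd ht hσ
      obtain ⟨x, hx, hxle⟩ := he.deriv_xiEnergy hw hP.isHermitian hare hK hrle hκ hκle ht.1 hσ
      obtain ⟨z, hz, hzle⟩ := he.deriv_sum_sq_gains hw c ht.1 hσ
      refine ⟨_, (((((hv.add (he.deriv_gainNorm ht.1 hσ)).add (hx.const_mul δ)).add
        (hz.const_mul δ')).sub ((HasDerivWithinAt.fun_sum fun i _ =>
          he.deriv_γ t σ ht.1 hσ i).const_mul β)).sub ((HasDerivWithinAt.fun_sum fun i _ =>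
          he.deriv_coupling t σ ht.1 hσ i).const_mul (2 * δ + δ'))).add
        ((hasDerivWithinAt_exp_neg_mul S.ϖ₂ t).const_mul (δ' * nf * S.μ₂ / S.ϖ₂)), ?_⟩
      have h5 : δ' * nf * S.μ₂ / S.ϖ₂ * (Real.exp (-S.ϖ₂ * t) * -S.ϖ₂) =
          -(δ' * (nf * S.μ₂ * Real.exp (-S.ϖ₂ * t))) := by field_simp
      rw [h5]
      rw [Fintype.sum_sum_type (fun j => sqNorm (e.errP σ t j))] at hxle hzle
      change _ + _ + _ + _ - _ - (2 * δ + δ') * ∑ i, sqNorm (e.thetaHat S σ i) + _ ≤ 0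
      have h6 := mul_le_mul_of_nonneg_left hxle hδ.le
      have h7 := mul_le_mul_of_nonneg_left hzle hδ'0.le
      rw [← hC] at hvle h6 h7
      have h8 : 0 ≤ ∑ i, e.coupling i t * sqNorm (e.errY σ t i) := Finset.sum_nonneg fun i _ =>
        mul_nonneg (zero_le_one.trans (he.one_lt_coupling i ht).le) (sqNorm_nonneg _)
      have h9 : 0 ≤ ∑ i : Fin nf, sqNorm (e.errP σ t (Sum.inr i)) :=
        Finset.sum_nonneg fun i _ => sqNorm_nonneg _
      generalize ∑ i, e.coupling i t * sqNorm (e.errY σ t i) = Ey at *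
      generalize ∑ i : Fin nf, sqNorm (e.errP σ t (Sum.inr i)) = Ef at *
      generalize ∑ i : Fin nl, sqNorm (e.errP σ t (Sum.inl i)) = El at *
      generalize ∑ i, sqNorm (e.thetaHat S σ i) = Θ at *
      generalize ∑ i : Fin nf, sqNorm (e.xi S (Sum.inr i) t) = Ξ at *
      generalize (nf : ℝ) * S.μ₂ * Real.exp (-S.ϖ₂ * t) = μ at *
      generalize (∑ i, e.coupling i t * sqNorm (e.thetaHat S σ i)) / e.gainNorm t = h' at *
      have h10 : δ * (-(r * Ξ) + 2 * κ * (C * (El + Ef)) + 2 * Θ) +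
          δ' * (2 * Ξ + 2 * (C * (El + Ef)) + Θ + μ - c * Ef - c * Ey) =
          β * (El + Ef) + (2 * δ + δ') * Θ + δ' * μ - (δ' * c) * (Ef + Ey) := by
        rw [hβ, hδ']; ring
      rw [hc] at h10
      have h11 : (C + β) * (Ef + Ey) = C * Ey + β * Ef + (C * Ef + β * Ey) := by ring
      have h12 : 0 ≤ C * Ef + β * Ey := by positivity
      linarith
  -- all terms of `L` with a negative sign are bounded or absorbed by half of the gain norm
  refine ⟨δ, δ', c, L 0 + β * (nl * Mγ), hδ, hδ'0, fun t ht => ?_⟩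
  have h0 : L t = _ := rfl
  have h1 := hL t ht
  have h2 : 0 ≤ e.energy S t / e.gainNorm t :=
    div_nonneg (hpsd.sum_dotProduct_nonneg _) (e.gainNorm_pos t).le
  have h3 : ∑ i, e.coupling i t ≤ nf * e.gainNorm t := by
    simpa using Finset.sum_le_sum (s := Finset.univ)
      fun (i : Fin nf) _ => e.coupling_le_gainNorm i t
  have h4 : ∑ i, e.γ i t ≤ nl * Mγ := by
    simpa using Finset.sum_le_sum (s := Finset.univ) fun (i : Fin nl) _ => hMγ i t ht
  have h5 : 0 ≤ δ' * nf * S.μ₂ / S.ϖ₂ * Real.exp (-S.ϖ₂ * t) := by positivity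
  have h6 := mul_le_mul_of_nonneg_left h3 (show 0 ≤ 2 * δ + δ' by positivity)
  have h7 := mul_le_mul_of_nonneg_right hδn (e.gainNorm_pos t).le
  have h8 := mul_le_mul_of_nonneg_left h4 hβ0
  have h9 : (2 * δ + δ') * (nf * e.gainNorm t) = (2 * δ + δ') * nf * e.gainNorm t := by ring
  linarith

theorem IsEvolution.followers_bounded (he : IsEvolution S e)
    (hw : ∀ i j, ¬ S.G.Adj i j → S.w i j = 0) (hpsd : (stressMatrix S.G S.w).PosSemidef)
    (hP : P.PosDef) (hR₁ : R₁.PosDef)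
    (hare : P * S.A + S.Aᵀ * P - P * S.B * S.Bᵀ * P + R₁ = 0) (hK : S.K = -(S.Bᵀ * P))
    (hμ₂ : 0 < S.μ₂) (hϖ₂ : 0 < S.ϖ₂) {Mγ : ℝ} (hMγ : ∀ i, ∀ t ∈ e.domain, e.γ i t ≤ Mγ) :
    ∃ M, ∀ t ∈ e.domain, ∀ i, e.coupling i t ≤ M ∧ e.phi i t ≤ M ∧ e.varphi i t ≤ M ∧
      sqNorm (e.xi S (Sum.inr i) t) ≤ M := by
  obtain ⟨ρ, hρ, hρle⟩ := hP.exists_le_dotProduct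
  obtain ⟨δ, δ', c, N, hδ, hδ'0, hbound⟩ :=
    he.lyapunov_bounded hw hpsd hP hR₁ hare hK hμ₂ hϖ₂ hMγ
  have hξ : ∀ (t : ℝ) (i : Fin nf),
      ρ * sqNorm (e.xi S (Sum.inr i) t) ≤ e.xiEnergy S P t := by
    intro t i
    refine (hρle _).trans (Finset.single_le_sum
      (f := fun i : Fin nf => e.xi S (Sum.inr i) t ⬝ᵥ P *ᵥ e.xi S (Sum.inr i) t)
      (fun i _ => (mul_nonneg hρ.le (sqNorm_nonneg _)).trans (hρle _)) (Finset.mem_univ i))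
  refine ⟨max (2 * N) (max (c + N / δ' + 1) (N / (δ * ρ))), fun t ht i => ?_⟩
  have h1 := hbound t ht
  have h2 := e.gainNorm_pos t
  have h3 : 0 ≤ δ * e.xiEnergy S P t := mul_nonneg hδ.le
    ((mul_nonneg hρ.le (sqNorm_nonneg _)).trans (hξ t i))
  have h4 := Finset.single_le_sum
    (f := fun i => (e.phi i t - c) ^ 2 / 2 + (e.varphi i t - c) ^ 2 / 2)
    (fun i _ => by positivity) (Finset.mem_univ i)
  have h5 : 0 ≤ δ' * ((e.phi i t - c) ^ 2 / 2 + (e.varphi i t - c) ^ 2 / 2) := by positivity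
  have h6 := mul_le_mul_of_nonneg_left h4 hδ'0.le
  have h7 : (e.phi i t - c) ^ 2 / 2 + (e.varphi i t - c) ^ 2 / 2 ≤ N / δ' := by
    rw [le_div_iff₀ hδ'0]; linarith
  refine ⟨le_max_of_le_left ?_, le_max_of_le_right (le_max_of_le_left ?_),
    le_max_of_le_right (le_max_of_le_left ?_), le_max_of_le_right (le_max_of_le_right ?_)⟩
  · have := e.coupling_le_gainNorm i t
    linarith
  · nlinarith [sq_nonneg (e.phi i t - c - 1), sq_nonneg (e.varphi i t - c)]
  · nlinarith [sq_nonneg (e.varphi i t - c - 1), sq_nonneg (e.phi i t - c)]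
  · rw [le_div_iff₀ (by positivity)]
    have h8 := mul_le_mul_of_nonneg_left (hξ t i) hδ.le
    have h9 : sqNorm (e.xi S (Sum.inr i) t) * (δ * ρ) =
      δ * (ρ * sqNorm (e.xi S (Sum.inr i) t)) := by ring
    linarith

end Boundedness

/-! ### Absence of Zeno behaviour -/

section Zeno

variable {nl nf d m : ℕ} {S : Scheme nl nf d m} {e : Evolution nl nf d m}

theorem norm_le_of_sqNorm_le {k : ℕ} {x : Fin k → ℝ} {M : ℝ} (h : sqNorm x ≤ M) :
    ‖x‖ ≤ M + 1 := by
  have h1 := norm_sq_le_sqNorm x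
  nlinarith [sq_nonneg (‖x‖ - 1)]

theorem exists_norm_mulVec_le {k l : ℕ} (M : Matrix (Fin l) (Fin k) ℝ) :
    ∃ C, 0 ≤ C ∧ ∀ x, ‖M *ᵥ x‖ ≤ C * ‖x‖ :=
  ⟨‖LinearMap.toContinuousLinearMap M.mulVecLin‖, norm_nonneg _, fun x =>
    (LinearMap.toContinuousLinearMap M.mulVecLin).le_opNorm x⟩

theorem exists_norm_p_le (hdet : IsUnit (stressMatrix S.G S.w).toBlocks₂₂.det) {D : Set ℝ} {M : ℝ}
    (hl : ∀ t ∈ D, ∀ i, sqNorm (e.p (Sum.inl i) t - S.pStar i) ≤ M)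
    (hf : ∀ t ∈ D, ∀ i, sqNorm (e.xi S (Sum.inr i) t) ≤ M) :
    ∃ M', 0 ≤ M' ∧ ∀ j, ∀ t ∈ D, ‖e.p j t‖ ≤ M' := by
  obtain ⟨M₁, -, hM₁⟩ := exists_common_bound (D := D) (f := fun (i : Fin nl) t =>
    ‖e.p (Sum.inl i) t‖) fun i => ⟨M + 1 + ‖S.pStar i‖, fun t ht => by
      have h1 := norm_le_of_sqNorm_le (hl t ht i)
      have h2 := norm_le_norm_sub_add (e.p (Sum.inl i) t) (S.pStar i)
      linarith⟩
  obtain ⟨M₂, hM₂0, hM₂⟩ := exists_common_bound (D := D) (f := fun (q : Fin nf × Fin d) t =>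
    |e.p (Sum.inr q.1) t q.2|) fun q => by
      let Q := ((stressMatrix S.G S.w).toBlocks₂₂⁻¹ * (stressMatrix S.G S.w).toBlocks₂₁) ⊗ₖ
        (1 : Matrix (Fin d) (Fin d) ℝ)
      refine ⟨∑ i, |(stressMatrix S.G S.w).toBlocks₂₂⁻¹ q.1 i| * (M + 1) + ∑ j, |Q q j| * M₁,
        fun t ht => ?_⟩
      have h := congrFun (formation_error_eq (stressMatrix S.G S.w) hdet fun j => e.p j t) q
      rw [Pi.add_apply] at h
      rw [eq_sub_of_add_eq h]
      refine (abs_sub _ _).trans (add_le_add ?_ ?_)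
      · refine (Finset.abs_sum_le_sum_abs _ _).trans (Finset.sum_le_sum fun i _ => ?_)
        rw [abs_mul]
        exact mul_le_mul_of_nonneg_left (abs_apply_le_of_sqNorm_le (hf t ht i) q.2)
          (abs_nonneg _)
      · refine (Finset.abs_sum_le_sum_abs _ _).trans (Finset.sum_le_sum fun j _ => ?_)
        rw [abs_mul]
        exact mul_le_mul_of_nonneg_left
          ((norm_le_pi_norm (e.p (Sum.inl j.1) t) j.2).trans (hM₁ j.1 t ht)) (abs_nonneg _)
  refine ⟨max M₁ M₂, le_max_of_le_right hM₂0, ?_⟩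
  rintro (i | i) t ht
  · exact le_max_of_le_left (hM₁ i t ht)
  · exact le_max_of_le_right ((pi_norm_le_iff_of_nonneg hM₂0).2 fun l => hM₂ (i, l) t ht)

/-- Since `‖d θ̂‖ ≤ M (1 + ‖θ̂‖²)` and `‖θ̂‖²` is the derivative of the bounded gain `d`, the
variation of the compensation estimates is controlled by the elapsed time and by the increments of
the gains. -/
theorem IsEvolution.norm_y_sub_le (he : IsEvolution S e) {M : ℝ}
    (hd : ∀ i, ∀ t ∈ e.domain, e.coupling i t ≤ M) (i : Fin nf) {s t : ℝ} (hs : s ∈ e.domain)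
    (ht : t ∈ e.domain) (hst : s ≤ t) :
    ‖e.y i t - e.y i s‖ ≤ M * (t + e.coupling i t) - M * (s + e.coupling i s) := by
  refine norm_sub_le_of_right_deriv_le e.ordConnected_domain (f := e.y i)
    (g := fun t => M * (t + e.coupling i t)) (he.continuous_y i)
    (continuousOn_const.mul (continuousOn_id.add (he.continuous_coupling i))) ?_ hs ht hst
  intro t ht
  obtain ⟨σ, hσ⟩ := he.exists_holds ht
  refine ⟨_, _, he.deriv_y t σ ht.1 hσ i,
    ((hasDerivWithinAt_id t _).add (he.deriv_coupling t σ ht.1 hσ i)).const_mul M, ?_⟩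
  have h1 := he.one_lt_coupling i ht
  rw [norm_neg, norm_smul, Real.norm_of_nonneg (by linarith)]
  have h2 := norm_sq_le_sqNorm (e.thetaHat S σ i)
  refine mul_le_mul (hd i t ht) ?_ (norm_nonneg _) (by linarith [hd i t ht])
  change _ ≤ 1 + sqNorm (e.thetaHat S σ i)
  nlinarith [sq_nonneg (‖e.thetaHat S σ i‖ - 1)]

/-- On a bounded time domain the inputs are bounded, hence the states are Lipschitz. -/
theorem IsEvolution.exists_norm_p_sub_le (he : IsEvolution S e) {M Mp T : ℝ}
    (hT : ∀ t ∈ e.domain, t ≤ T)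
    (hd : ∀ i, ∀ t ∈ e.domain, e.coupling i t ≤ M) (hp : ∀ j, ∀ t ∈ e.domain, ‖e.p j t‖ ≤ Mp) :
    ∃ C, ∀ j, ∀ s ∈ e.domain, ∀ t ∈ e.domain, s ≤ t → ‖e.p j t - e.p j s‖ ≤ C * t - C * s := by
  obtain ⟨My, hMy0, hMy⟩ := exists_common_bound (D := e.domain)
    (f := fun i t => ‖e.y i t‖) fun i => ⟨M * (T + M) + ‖e.y i 0‖, fun t ht => by
      have h1 := he.norm_y_sub_le hd i he.zero_mem ht ht.1
      have h2 := norm_le_norm_sub_add (e.y i t) (e.y i 0)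
      have h3 := he.init_coupling i
      have h4 := hd i t ht
      have h5 := he.one_lt_coupling i ht
      have h6 := mul_le_mul_of_nonneg_left (add_le_add (hT t ht) h4)
        (show 0 ≤ M by linarith)
      have h7 : 0 ≤ M * (0 + e.coupling i 0) := mul_nonneg (by linarith) (by linarith)
      linarith⟩
  obtain ⟨a, ha, hA⟩ := exists_norm_mulVec_le S.A
  obtain ⟨b, hb, hB⟩ := exists_norm_mulVec_le S.B
  obtain ⟨k, hk, hK⟩ := exists_norm_mulVec_le S.K
  set Mv := ∑ i, ‖S.v i‖ with hMv
  have hv : ∀ i, ‖S.v i‖ ≤ Mv := fun i =>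
    Finset.single_le_sum (f := fun i => ‖S.v i‖) (fun _ _ => norm_nonneg _) (Finset.mem_univ i)
  have hMv0 : 0 ≤ Mv := by positivity
  let C := a * Mp + b * (k * Mp + (Mv + My))
  refine ⟨C, fun j s hs t ht hst => norm_sub_le_of_right_deriv_le e.ordConnected_domain
    (g := fun t => C * t) (he.continuous_p j) (by fun_prop) ?_ hs ht hst⟩
  intro t ht
  obtain ⟨σ, hσ⟩ := he.exists_holds ht
  refine ⟨_, _, he.deriv_p t σ ht.1 hσ j, (hasDerivWithinAt_id t _).const_mul C, ?_⟩
  have hin : ‖e.input S σ j‖ ≤ k * Mp + (Mv + My) := by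
    have hph : ∀ j, ‖S.K *ᵥ e.pHat σ j‖ ≤ k * Mp := fun j => (hK _).trans
      (mul_le_mul_of_nonneg_left (hp j _ (he.toReal_τ_mem ht (hσ j).1).1) hk)
    cases j with
    | inl i =>
      exact (norm_add_le _ _).trans (add_le_add (hph _) ((hv i).trans (by linarith)))
    | inr i =>
      exact (norm_add_le _ _).trans (add_le_add (hph _)
        ((hMy i _ (he.toReal_τ_mem ht (hσ (Sum.inr i)).1).1).trans (by linarith)))
  rw [mul_one]
  exact (norm_add_le _ _).trans (add_le_add
    ((hA _).trans (mul_le_mul_of_nonneg_left (hp j t ht) ha))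
    ((hB _).trans (mul_le_mul_of_nonneg_left hin hb)))

theorem tendsto_increments_zero {u : ℕ → ℝ} (hu : Monotone u) {M : ℝ} (hM : ∀ k, u k ≤ M) :
    Tendsto (fun k => u (k + 1) - u k) atTop (𝓝 0) := by
  have h := tendsto_atTop_ciSup hu ⟨M, by rintro _ ⟨k, rfl⟩; exact hM k⟩
  simpa using (h.comp (tendsto_add_atTop_nat 1)).sub h

theorem tendsto_sqNorm_zero {k : ℕ} {x : ℕ → Fin k → ℝ} {b : ℕ → ℝ} (hx : ∀ n, ‖x n‖ ≤ b n)
    (hb : Tendsto b atTop (𝓝 0)) : Tendsto (fun n => sqNorm (x n)) atTop (𝓝 0) := by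
  have h : Tendsto (fun n => (k : ℝ) * b n ^ 2) atTop (𝓝 0) := by
    simpa using (hb.pow 2).const_mul (k : ℝ)
  refine squeeze_zero (fun _ => sqNorm_nonneg _) (fun n => (sqNorm_le_card_mul_norm_sq _).trans ?_)
    h
  exact mul_le_mul_of_nonneg_left (pow_le_pow_left₀ (norm_nonneg _) (hx n) 2) (by positivity)

/-- If the triggering instants of an agent accumulated at a finite time, its measurement errors
just before triggering would tend to zero, since its signals have finite variation; but the
triggering rule keeps them away from zero as long as the adaptive parameters are bounded. -/
theorem IsEvolution.horizon_eq_top (he : IsEvolution S e) (hμ₁ : 0 < S.μ₁) (hϖ₁ : 0 < S.ϖ₁)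
    (hμ₂ : 0 < S.μ₂) (hϖ₂ : 0 < S.ϖ₂) {M Mp : ℝ}
    (hγ : ∀ i, ∀ t ∈ e.domain, e.γ i t ≤ M) (hd : ∀ i, ∀ t ∈ e.domain, e.coupling i t ≤ M)
    (hφ : ∀ i, ∀ t ∈ e.domain, e.phi i t ≤ M) (hφ' : ∀ i, ∀ t ∈ e.domain, e.varphi i t ≤ M)
    (hp : ∀ j, ∀ t ∈ e.domain, ‖e.p j t‖ ≤ Mp) : e.horizon = ⊤ := by
  by_contra htop
  have hne : Nonempty (Agent nl nf) := by
    by_contra h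
    rw [not_nonempty_iff] at h
    exact htop (iInf_of_empty _)
  obtain ⟨T, hTh⟩ : ∃ T : ℝ, (T : EReal) = e.horizon :=
    ⟨_, EReal.coe_toReal htop (ne_bot_of_gt he.horizon_pos)⟩
  have hT : ∀ t ∈ e.domain, t ≤ T := fun t ht => by
    have := ht.2.le
    rw [← hTh] at this
    exact_mod_cast this
  obtain ⟨C, hC⟩ := he.exists_norm_p_sub_le hT hd hp
  -- the agent whose triggering instants accumulate first
  obtain ⟨i, hi⟩ := exists_eq_ciInf_of_finite (f := fun i => ⨆ k, e.τ i k)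
  have hle : ∀ k, e.τ i k ≤ e.horizon := fun k => by
    rw [Evolution.horizon, ← hi]
    exact le_iSup (e.τ i) k
  have hfin : ∀ k, e.τ i k ≠ ⊤ := fun k => ne_top_of_le_ne_top htop (hle k)
  have hlt : ∀ k, e.τ i k < e.horizon := fun k => (he.τ_lt i k (hfin k)).trans_le (hle (k + 1))
  set u : ℕ → ℝ := fun k => (e.τ i k).toReal with hu
  have hcoe : ∀ k, (u k : EReal) = e.τ i k := fun k =>
    EReal.coe_toReal (hfin k) (ne_bot_of_le_ne_bot EReal.zero_ne_bot (he.τ_nonneg i k))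
  have hmem : ∀ k, u k ∈ e.domain := fun k =>
    ⟨EReal.toReal_nonneg (he.τ_nonneg i k), by rw [hcoe]; exact hlt k⟩
  have hmono : Monotone u := monotone_nat_of_le_succ fun k => by
    have := he.τ_le_succ i k
    rw [← hcoe, ← hcoe] at this
    exact_mod_cast this
  have hstep := tendsto_increments_zero hmono fun k => hT _ (hmem k)
  have hεp : ∀ j, Tendsto (fun k => sqNorm (e.p j (u k) - e.p j (u (k + 1)))) atTop (𝓝 0) :=
    fun j => tendsto_sqNorm_zero (b := fun k => C * (u (k + 1) - u k)) (fun k => by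
      rw [norm_sub_rev, mul_sub]
      exact hC j _ (hmem k) _ (hmem (k + 1)) (hmono k.le_succ))
      (by simpa using hstep.const_mul C)
  have hexp : ∀ {ϖ : ℝ}, 0 < ϖ → ∀ k, Real.exp (-ϖ * T) ≤ Real.exp (-ϖ * u k) := fun h k => by
    rw [Real.exp_le_exp, neg_mul, neg_mul, neg_le_neg_iff]
    exact mul_le_mul_of_nonneg_left (hT _ (hmem k)) h.le
  cases i with
  | inl i =>
    have hlim := (hεp (Sum.inl i)).const_mul M
    rw [mul_zero] at hlim
    refine absurd (ge_of_tendsto' hlim fun k => ?_) (not_le.2 (mul_pos hμ₁ (Real.exp_pos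
      (-S.ϖ₁ * T))))
    obtain ⟨σ, hσk, -, htr⟩ := he.trigger_nonneg (Sum.inl i) k (u (k + 1)) (hcoe (k + 1)).symm
      (hmem (k + 1)).2
    have herr : e.errP σ (u (k + 1)) (Sum.inl i) =
        e.p (Sum.inl i) (u k) - e.p (Sum.inl i) (u (k + 1)) := by
      simp only [Evolution.errP, Evolution.pHat, hσk, hu]
    simp only [Evolution.trigger, herr] at htr
    have h1 := sqNorm_nonneg (e.pHat σ (Sum.inl i) - S.pStar i)
    have h2 := mul_le_mul_of_nonneg_left (hexp hϖ₁ (k + 1)) hμ₁.le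
    have h3 := mul_le_mul_of_nonneg_right (hγ i _ (hmem (k + 1)))
      (sqNorm_nonneg (e.p (Sum.inl i) (u k) - e.p (Sum.inl i) (u (k + 1))))
    linarith
  | inr i =>
    have hM0 : 0 ≤ M := by linarith [he.one_lt_coupling i (hmem 0), hd i _ (hmem 0)]
    have hdstep := tendsto_increments_zero
      (fun k l hkl => he.coupling_mono i (hmem k) (hmem l) (hmono hkl)) fun k => hd i _ (hmem k)
    have hεy : Tendsto (fun k => sqNorm (e.y i (u k) - e.y i (u (k + 1)))) atTop (𝓝 0) :=
      tendsto_sqNorm_zero (b := fun k => M * ((u (k + 1) - u k) +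
        (e.coupling i (u (k + 1)) - e.coupling i (u k)))) (fun k => by
        rw [norm_sub_rev]
        refine (he.norm_y_sub_le hd i (hmem k) (hmem (k + 1)) (hmono k.le_succ)).trans_eq ?_
        ring)
        (by simpa using (hstep.add hdstep).const_mul M)
    have hlim := ((hεp (Sum.inr i)).const_mul M).add (hεy.const_mul (M * M))
    rw [mul_zero, mul_zero, add_zero] at hlim
    refine absurd (ge_of_tendsto' hlim fun k => ?_) (not_le.2 (mul_pos hμ₂ (Real.exp_pos
      (-S.ϖ₂ * T))))
    obtain ⟨σ, hσk, -, htr⟩ := he.trigger_nonneg (Sum.inr i) k (u (k + 1)) (hcoe (k + 1)).symm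
      (hmem (k + 1)).2
    have herr : e.errP σ (u (k + 1)) (Sum.inr i) =
        e.p (Sum.inr i) (u k) - e.p (Sum.inr i) (u (k + 1)) := by
      simp only [Evolution.errP, Evolution.pHat, hσk, hu]
    have herr' : e.errY σ (u (k + 1)) i = e.y i (u k) - e.y i (u (k + 1)) := by
      simp only [Evolution.errY, Evolution.yHat, hσk, hu]
    simp only [Evolution.trigger, herr, herr'] at htr
    have h0 := sqNorm_nonneg (e.xiHat S σ (Sum.inr i))
    have h1 := sqNorm_nonneg (e.thetaHat S σ i)
    have h2 := mul_le_mul_of_nonneg_left (hexp hϖ₂ (k + 1)) hμ₂.le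
    have h3 := mul_le_mul_of_nonneg_right (hφ' i _ (hmem (k + 1)))
      (sqNorm_nonneg (e.p (Sum.inr i) (u k) - e.p (Sum.inr i) (u (k + 1))))
    have h4 : e.phi i (u (k + 1)) * e.coupling i (u (k + 1)) ≤ M * M :=
      mul_le_mul (hφ i _ (hmem (k + 1))) (hd i _ (hmem (k + 1)))
        (zero_le_one.trans (he.one_lt_coupling i (hmem (k + 1))).le) hM0
    have h5 := mul_le_mul_of_nonneg_right h4
      (sqNorm_nonneg (e.y i (u k) - e.y i (u (k + 1))))
    linarith

end Zeno

/-! ### Convergence -/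

section Convergence

variable {nl nf d m : ℕ} {S : Scheme nl nf d m} {e : Evolution nl nf d m}
  {P R₁ : Matrix (Fin d) (Fin d) ℝ}

/-- The energy of the `ξ_i` decays exponentially up to the derivative of the sum of the bounded
adaptive parameters `γ_i`, `varphi_i` and `d_i`. -/
theorem IsEvolution.xi_tendsto (he : IsEvolution S e)
    (hw : ∀ i j, ¬ S.G.Adj i j → S.w i j = 0) (hP : P.PosDef) (hR₁ : R₁.PosDef)
    (hare : P * S.A + S.Aᵀ * P - P * S.B * S.Bᵀ * P + R₁ = 0) (hK : S.K = -(S.Bᵀ * P))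
    (htop : e.horizon = ⊤) {M : ℝ} (hγ : ∀ i, ∀ t ∈ e.domain, e.γ i t ≤ M)
    (hd : ∀ i, ∀ t ∈ e.domain, e.coupling i t ≤ M)
    (hφ' : ∀ i, ∀ t ∈ e.domain, e.varphi i t ≤ M) (i : Fin nf) :
    Tendsto (e.xi S (Sum.inr i)) atTop (𝓝 0) := by
  obtain ⟨r, hr, hrle⟩ := hR₁.exists_le_dotProduct
  obtain ⟨ρ, hρ, hρle⟩ := hP.exists_le_dotProduct
  obtain ⟨ρ', hρ', hρ'le⟩ := exists_dotProduct_mulVec_le P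
  obtain ⟨κ, hκ, hκle⟩ := exists_sqNorm_mulVec_le S.K
  have hD := e.domain_eq_Ici htop
  have hmem : ∀ t, 0 ≤ t → t ∈ e.domain := fun t ht => hD ▸ ht
  have hterm : ∀ t i, 0 ≤ e.xi S (Sum.inr i) t ⬝ᵥ P *ᵥ e.xi S (Sum.inr i) t :=
    fun t i => (mul_nonneg hρ.le (sqNorm_nonneg _)).trans (hρle _)
  set C := 2 * κ * ∑ i, ∑ j, stressMatrix S.G S.w i j ^ 2 with hC
  have hC0 : 0 ≤ C := by positivity
  have hX := tendsto_zero_of_right_deriv_le (f := e.xiEnergy S P)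
    (g := fun t => C * (∑ i, e.γ i t + ∑ i, e.varphi i t) + 2 * ∑ i, e.coupling i t)
    (δ := r / ρ') (M := C * (∑ _i : Fin nl, M + ∑ _i : Fin nf, M) + 2 * ∑ _i : Fin nf, M)
    (by positivity) (hD ▸ he.continuousOn_xiEnergy)
    (hD ▸ (continuousOn_const.mul ((continuousOn_finsetSum _ fun i _ => he.continuous_γ i).add
      (continuousOn_finsetSum _ fun i _ => he.continuous_varphi i))).add
      (continuousOn_const.mul (continuousOn_finsetSum _ fun i _ => he.continuous_coupling i)))
    (fun t _ => Finset.sum_nonneg fun i _ => hterm t i)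
    (fun s t hs hst => by
      have hs' := hmem s hs
      have ht' := hmem t (hs.trans hst)
      gcongr with i _ i _ i _
      · exact he.γ_mono i hs' ht' hst
      · exact he.varphi_mono i hs' ht' hst
      · exact he.coupling_mono i hs' ht' hst)
    (fun t ht => by
      have ht' := hmem t ht
      gcongr with i _ i _ i _
      · exact hγ i t ht'
      · exact hφ' i t ht'
      · exact hd i t ht')
    (fun t ht => by
      obtain ⟨σ, hσ⟩ := he.exists_holds (hmem t ht)
      obtain ⟨c, hc, hcle⟩ := he.deriv_xiEnergy hw hP.isHermitian hare hK hrle hκ hκle ht hσ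
      refine ⟨c, _, hc,
        (((HasDerivWithinAt.fun_sum fun i _ => he.deriv_γ t σ ht hσ i).add
          (HasDerivWithinAt.fun_sum fun i _ => he.deriv_varphi t σ ht hσ i)).const_mul C).add
        ((HasDerivWithinAt.fun_sum fun i _ => he.deriv_coupling t σ ht hσ i).const_mul 2), ?_⟩
      refine hcle.trans ?_
      have h1 : e.xiEnergy S P t ≤ ρ' * ∑ i, sqNorm (e.xi S (Sum.inr i) t) := by
        rw [Finset.mul_sum]
        exact Finset.sum_le_sum fun i _ => hρ'le _
      have h2 := mul_le_mul_of_nonneg_left h1 (show 0 ≤ r / ρ' by positivity)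
      have h3 : r / ρ' * (ρ' * ∑ i, sqNorm (e.xi S (Sum.inr i) t)) =
        r * ∑ i, sqNorm (e.xi S (Sum.inr i) t) := by field_simp
      rw [← mul_assoc, ← hC, Fintype.sum_sum_type (fun j => sqNorm (e.errP σ t j))]
      change _ ≤ _ + (_ + 2 * ∑ i, sqNorm (e.thetaHat S σ i))
      linarith)
  have hX' := hX.const_mul ρ⁻¹
  rw [mul_zero] at hX'
  refine tendsto_zero_of_sqNorm (squeeze_zero (fun _ => sqNorm_nonneg _) (fun t => ?_) hX')
  rw [← div_eq_inv_mul, le_div_iff₀ hρ, mul_comm]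
  exact (hρle _).trans (Finset.single_le_sum
    (f := fun i : Fin nf => e.xi S (Sum.inr i) t ⬝ᵥ P *ᵥ e.xi S (Sum.inr i) t)
    (fun i _ => hterm t i) (Finset.mem_univ i))

end Convergence

theorem theorem1 {nl nf d m : ℕ} (S : Scheme nl nf d m)
    (a : Agent nl nf → Fin d → ℝ)
    (hstress : IsEquilibriumStress S.G S.w a)
    (hspan : affineSpan ℝ (Set.range fun i : Fin nl => a (Sum.inl i)) = ⊤)
    (hpsd : (stressMatrix S.G S.w).PosSemidef)
    (hrank : (stressMatrix S.G S.w).rank + d + 1 = nl + nf)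
    (hstab : IsStabilizable S.A S.B)
    (Υ : Matrix (Fin d) (Fin d) ℝ) (υ : Fin d → ℝ)
    (htarget : ∀ i, S.pStar i = Υ *ᵥ a (Sum.inl i) + υ)
    (P R₁ : Matrix (Fin d) (Fin d) ℝ) (hP : P.PosDef) (hR₁ : R₁.PosDef)
    (hare : P * S.A + S.Aᵀ * P - P * S.B * S.Bᵀ * P + R₁ = 0)
    (hK : S.K = -(S.Bᵀ * P))
    (hv : ∀ i, (S.A + S.B * S.K) *ᵥ S.pStar i + S.B *ᵥ S.v i = 0)
    (hμ₁ : 0 < S.μ₁) (hϖ₁ : 0 < S.ϖ₁) (hμ₂ : 0 < S.μ₂) (hϖ₂ : 0 < S.ϖ₂)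
    (e : Evolution nl nf d m) (he : IsEvolution S e) :
    -- the evolution exists for all times: triggering instants do not accumulate
    e.horizon = ⊤ ∧
    -- the leaders converge to their targets
    (∀ i, Tendsto (fun t => e.p (Sum.inl i) t - S.pStar i) atTop (𝓝 0)) ∧
    -- the followers converge to the affine formation given by the leaders
    IsUnit (stressMatrix S.G S.w).toBlocks₂₂.det ∧
    Tendsto
      (fun t => (fun x : Fin nf × Fin d => e.p (Sum.inr x.1) t x.2) +
        (((stressMatrix S.G S.w).toBlocks₂₂⁻¹ * (stressMatrix S.G S.w).toBlocks₂₁) ⊗ₖ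
            (1 : Matrix (Fin d) (Fin d) ℝ)) *ᵥ
          (fun x : Fin nl × Fin d => e.p (Sum.inl x.1) t x.2))
      atTop (𝓝 0) ∧
    -- the adaptive gains stay bounded and converge to finite constants
    (∃ M : ℝ, ∀ t : ℝ, 0 ≤ t →
      (∀ i, |e.coupling i t| ≤ M ∧ |e.phi i t| ≤ M ∧ |e.varphi i t| ≤ M) ∧ ∀ i, |e.γ i t| ≤ M) ∧
    (∀ i, ∃ c c' c'' : ℝ, Tendsto (e.coupling i) atTop (𝓝 c) ∧
      Tendsto (e.phi i) atTop (𝓝 c') ∧ Tendsto (e.varphi i) atTop (𝓝 c'')) ∧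
    (∀ i, ∃ c : ℝ, Tendsto (e.γ i) atTop (𝓝 c)) := by
  have hw := hstress.support
  have hdet := isUnit_det_stressMatrix_toBlocks₂₂ hstress hspan hpsd hrank
  have hl := he.leader_bounded hP hR₁ hare hK hv hμ₁ hϖ₁
  obtain ⟨Mγ, -, hMγ⟩ := exists_common_bound (D := e.domain) (f := e.γ)
    fun i => (hl i).imp fun M h t ht => (h t ht).1
  obtain ⟨Ml, -, hMl⟩ := exists_common_bound (D := e.domain)
    (f := fun i t => sqNorm (e.p (Sum.inl i) t - S.pStar i))
    fun i => (hl i).imp fun M h t ht => (h t ht).2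
  obtain ⟨Mf, hMf⟩ := he.followers_bounded hw hpsd hP hR₁ hare hK hμ₂ hϖ₂ hMγ
  obtain ⟨Mp, -, hMp⟩ := exists_norm_p_le (D := e.domain) (M := max Ml Mf) hdet
    (fun t ht i => le_max_of_le_left (hMl i t ht))
    (fun t ht i => le_max_of_le_right (hMf t ht i).2.2.2)
  let M := max Mγ Mf
  have hγ : ∀ i, ∀ t ∈ e.domain, e.γ i t ≤ M := fun i t ht => le_max_of_le_left (hMγ i t ht)
  have hd : ∀ i, ∀ t ∈ e.domain, e.coupling i t ≤ M := fun i t ht =>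
    le_max_of_le_right (hMf t ht i).1
  have hφ : ∀ i, ∀ t ∈ e.domain, e.phi i t ≤ M := fun i t ht =>
    le_max_of_le_right (hMf t ht i).2.1
  have hφ' : ∀ i, ∀ t ∈ e.domain, e.varphi i t ≤ M := fun i t ht =>
    le_max_of_le_right (hMf t ht i).2.2.1
  have htop := he.horizon_eq_top hμ₁ hϖ₁ hμ₂ hϖ₂ hγ hd hφ hφ' hMp
  have hmem : ∀ t, 0 ≤ t → t ∈ e.domain := fun t ht => e.domain_eq_Ici htop ▸ ht
  have hmono : ∀ {f : ℝ → ℝ}, (∀ {s t : ℝ}, s ∈ e.domain → t ∈ e.domain → s ≤ t → f s ≤ f t) →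
      ∀ s t, 0 ≤ s → s ≤ t → f s ≤ f t := fun h s t hs hst =>
    h (hmem s hs) (hmem t (hs.trans hst)) hst
  refine ⟨htop, fun i => he.leader_tendsto hP hR₁ hare hK hv htop i (hγ i), hdet, ?_, ?_,
    fun i => ?_, fun i => ?_⟩
  · refine Tendsto.congr (fun t => (formation_error_eq _ hdet fun j => e.p j t).symm) ?_
    rw [tendsto_pi_nhds]
    intro q
    have h := tendsto_finsetSum Finset.univ fun (i : Fin nf) _ =>
      ((tendsto_pi_nhds.1 (he.xi_tendsto hw hP hR₁ hare hK htop hγ hd hφ' i)) q.2).const_mul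
        ((stressMatrix S.G S.w).toBlocks₂₂⁻¹ q.1 i)
    simp only [Pi.zero_apply, mul_zero, Finset.sum_const_zero] at h
    exact h
  · -- the gains are nondecreasing, so their initial values bound them from below
    have hN : ∀ {f : ℝ → ℝ} {N : ℝ}, (∀ t ∈ e.domain, f t ≤ M) →
        (∀ {s t : ℝ}, s ∈ e.domain → t ∈ e.domain → s ≤ t → f s ≤ f t) → |f 0| ≤ N →
        ∀ t, 0 ≤ t → |f t| ≤ |M| + N := by
      intro f N h1 h2 h3 t ht
      have h4 := h1 t (hmem t ht)
      have h5 := hmono h2 0 t le_rfl ht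
      have h6 := (abs_nonneg (f 0)).trans h3
      have h7 := (abs_le.1 h3).1
      rw [abs_le]
      constructor <;> linarith [le_abs_self M, abs_nonneg M]
    have hsum : ∀ {n : ℕ} (f : Fin n → ℝ) (i : Fin n), |f i| ≤ ∑ i, |f i| := fun f i =>
      Finset.single_le_sum (f := fun i => |f i|) (fun _ _ => abs_nonneg _) (Finset.mem_univ i)
    have h0 : ∀ {n : ℕ} (f : Fin n → ℝ), 0 ≤ ∑ i, |f i| := fun f => by positivity
    have h1 := h0 fun i => e.coupling i 0
    have h2 := h0 fun i => e.phi i 0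
    have h3 := h0 fun i => e.varphi i 0
    have h4 := h0 fun i => e.γ i 0
    refine ⟨|M| + (∑ i, |e.coupling i 0| + ∑ i, |e.phi i 0| + ∑ i, |e.varphi i 0| +
      ∑ i, |e.γ i 0|), fun t ht => ⟨fun i => ⟨?_, ?_, ?_⟩, fun i => ?_⟩⟩
    · refine hN (hd i) (he.coupling_mono i) ?_ t ht
      linarith [hsum (fun i => e.coupling i 0) i]
    · refine hN (hφ i) (he.phi_mono i) ?_ t ht
      linarith [hsum (fun i => e.phi i 0) i]
    · refine hN (hφ' i) (he.varphi_mono i) ?_ t ht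
      linarith [hsum (fun i => e.varphi i 0) i]
    · refine hN (hγ i) (he.γ_mono i) ?_ t ht
      linarith [hsum (fun i => e.γ i 0) i]
  · obtain ⟨c, hc⟩ := exists_tendsto_of_mono_bdd (hmono (he.coupling_mono i))
      fun t ht => hd i t (hmem t ht)
    obtain ⟨c', hc'⟩ := exists_tendsto_of_mono_bdd (hmono (he.phi_mono i))
      fun t ht => hφ i t (hmem t ht)
    obtain ⟨c'', hc''⟩ := exists_tendsto_of_mono_bdd (hmono (he.varphi_mono i))
      fun t ht => hφ' i t (hmem t ht)
    exact ⟨c, c', c'', hc, hc', hc''⟩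
  · exact exists_tendsto_of_mono_bdd (hmono (he.γ_mono i)) fun t ht => hγ i t (hmem t ht)
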